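/- Let $A$ be a commutative ring, $A^\times$ its group of units, $\mathcal G_A=A^\times/(A^\times)^2$, and write $\langle a\rangle\in\mathcal G_A$ for the class of $a\in A^\times$. Let $\mu_2(A)=\{a\in A: a^2=1\}$, $\mathrm{PSL}_2(A)=\mathrm{SL}_2(A)/\mu_2(A)I_2$, and let $\mathrm{PT}(A)$, $\mathrm{PB}(A)$, $\mathrm{PSM}_2(A)$ be the images in $\mathrm{PSL}_2(A)$ of the groups of diagonal, upper triangular and monomial matrices in $\mathrm{SL}_2(A)$ (a matrix in $\mathrm{SL}_2(A)$ is monomial if it is of the form $\begin{pmatrix}a&0\\0&a^{-1}\end{pmatrix}$ or $\begin{pmatrix}0&a\\-a^{-1}&0\end{pmatrix}$ with $a\in A^\times$). For $n\ge 0$ let $X_n(A^2)$ be the free abelian group on the $(n+1)$-tuples $(\langle v_0\rangle,\dots,\langle v_n\rangle)$ of submodules $\langle v_i\rangle=v_iA$ of $A^2$, where every $v_i$ is unimodular and $v_i,v_j$ form a basis of $A^2$ whenever $i\ne j$. Let $\partial_n:X_n(A^2)\to X_{n-1}(A^2)$ be the alternating sum of the maps omitting the $i$-th entry, let $\epsilon:X_0(A^2)\to\mathbb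 Z$ send every generator to $1$, and put $Z_2(A^2)=\ker\partial_2$. Let $$\mathcal{RP}(A)=H_0(\mathrm{SL}_2(A),Z_2(A^2)),\qquad \mathcal{RP}_1(A)=\ker\bigl(\mathcal{RP}(A)\to H_0(\mathrm{SL}_2(A),X_2(A^2))\bigr),$$ the map being induced by the inclusion $Z_2(A^2)\subseteq X_2(A^2)$. These are $\mathbb Z[\mathcal G_A]$-modules, where $\langle a\rangle$ acts through any matrix in $\mathrm{GL}_2(A)$ of determinant $a$. With $\boldsymbol\infty=\langle e_1\rangle$, $\mathbf 0=\langle e_2\rangle$ and $\mathbf a=\langle e_1+ae_2\rangle$ for $a\in A^\times$, let $\psi_1(-1)\in\mathcal{RP}_1(A)$ be the class of $$(\boldsymbol\infty,\mathbf 0,\mathbf{-1})+(\mathbf 0,\boldsymbol\infty,\mathbf{-1})-(\boldsymbol\infty,\mathbf 0,\mathbf 1)-(\mathbf 0,\boldsymbol\infty,\mathbf 1).$$ **Theorem 4.2.** Assume that 1. $X_\bullet(A^2)\to\mathbb Z$ is exact in dimension $<2$, that is, $\epsilon$ induces an isomorphism $H_0(X_\bullet(A^2))\simeq\mathbb Z$,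 and $H_1(X_\bullet(A^2))=0$; 2. $\mu_2(A)=\{\pm1\}$; 3. for $i=2,3$ the inclusion $\mathrm{PT}(A)\subseteq\mathrm{PB}(A)$ induces an isomorphism $H_i(\mathrm{PT}(A),\mathbb Z)\simeq H_i(\mathrm{PB}(A),\mathbb Z)$. Then there is an isomorphism of abelian groups $$H_3(\mathrm{PSL}_2(A),\mathrm{PSM}_2(A);\mathbb Z)\simeq \mathcal{RP}_1(A)/\mathbb Z[\mathcal G_A]\,\psi_1(-1),$$ where $H_n(G,K;\mathbb Z)$ denotes the homology of the quotient of the bar complex of $G$ by the bar complex of its subgroup $K$. -/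

import Mathlib

open CategoryTheory
open scoped MatrixGroups

universe u

noncomputable section

namespace RefinedScissors

/-! ### The complex of tuples of pairwise independent unimodular lines -/

section Complex

variable (A : Type u) [CommRing A]

/-- A vector `(v₁, v₂)` of `A²` is unimodular if `v₁ A + v₂ A = A`. -/
def Unimodular {A : Type u} [CommRing A] (v : Fin 2 → A) : Prop := IsCoprime (v 0) (v 1)

/-- `v, w` form a basis of the free module `A²`. -/
def IsBasisPair {A : Type u} [CommRing A] (v w : Fin 2 → A) : Prop :=
  LinearIndependent A ![v, w] ∧ Submodule.span A (Set.range ![v, w]) = ⊤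

/-- The generators of the `n`-th chain group: tuples `(⟨v₀⟩, …, ⟨vₙ⟩)` of lines `⟨v⟩ = vA` spanned
by unimodular vectors, any two of which form a basis of `A²`. -/
@[ext]
structure Simplex (n : ℕ) : Type u where
  /-- the lines `⟨v₀⟩, …, ⟨vₙ⟩` -/
  line : Fin (n + 1) → Submodule A (Fin 2 → A)
  exists_vec : ∃ v : Fin (n + 1) → Fin 2 → A, (∀ i, Unimodular (v i)) ∧
    (∀ i, line i = Submodule.span A {v i}) ∧ ∀ i j, i ≠ j → IsBasisPair (v i) (v j)

/-- The chain group `X_n(A²)`: the free abelian group on the simplices. -/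
abbrev X (n : ℕ) : Type u := Simplex A n →₀ ℤ

variable {A}

/-- Omit the `i`-th line. -/
def face {n : ℕ} (i : Fin (n + 2)) (p : Simplex A (n + 1)) : Simplex A n :=
  ⟨fun j => p.line (i.succAbove j), by
    obtain ⟨v, h1, h2, h3⟩ := p.exists_vec
    exact ⟨fun j => v (i.succAbove j), fun j => h1 _, fun j => h2 _,
      fun j k hjk => h3 _ _ fun h => hjk (Fin.succAbove_right_injective h)⟩⟩

variable (A)

/-- `bdry A n` is the differential `∂_{n+1} : X_{n+1}(A²) → X_n(A²)`, the alternating sum of the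
face operators. -/
def bdry (n : ℕ) : X A (n + 1) →ₗ[ℤ] X A n :=
  ∑ i : Fin (n + 2), (-1 : ℤ) ^ (i : ℕ) • Finsupp.lmapDomain ℤ ℤ (face i)

/-- The augmentation `ε : X_0(A²) → ℤ`, `∑ nᵢ (⟨vᵢ⟩) ↦ ∑ nᵢ`. -/
def aug : X A 0 →ₗ[ℤ] ℤ := Finsupp.lsum ℤ fun _ => LinearMap.id

/-- `X_•(A²) → ℤ → 0` is exact in dimension `< 2`: the augmentation induces
`H_0(X_•(A²)) ≃ ℤ`, and `H_1(X_•(A²)) = 0`. -/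
def ExactBelowTwo : Prop :=
  Function.Surjective (aug A) ∧ Function.Exact (bdry A 0) (aug A) ∧
    Function.Exact (bdry A 1) (bdry A 0)

variable {A}

theorem IsBasisPair.map {v w : Fin 2 → A} (h : IsBasisPair v w) (g : GL (Fin 2) A) :
    IsBasisPair (g.1.mulVec v) (g.1.mulVec w) := by
  have e : ![g.1.mulVec v, g.1.mulVec w] = g.1.mulVecLin ∘ ![v, w] := by
    funext i; fin_cases i <;> rfl
  have hinj : Function.Injective g.1.mulVecLin := Matrix.mulVec_injective_of_isUnit g.isUnit
  have hsurj : Function.Surjective g.1.mulVecLin := Matrix.mulVec_surjective_iff_isUnit.2 g.isUnit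
  refine ⟨?_, ?_⟩
  · rw [e]
    exact h.1.map' _ (LinearMap.ker_eq_bot.2 hinj)
  · rw [e, Set.range_comp, Submodule.span_image, h.2, Submodule.map_top]
    exact LinearMap.range_eq_top.2 hsurj

theorem Unimodular.map {v : Fin 2 → A} (h : Unimodular v) (g : GL (Fin 2) A) :
    Unimodular (g.1.mulVec v) := by
  obtain ⟨a, b, hab⟩ := h
  have hg : g⁻¹.1.mulVec (g.1.mulVec v) = v := by
    rw [Matrix.mulVec_mulVec, ← Units.val_mul, inv_mul_cancel, Units.val_one, Matrix.one_mulVec]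
  have h0 := congrFun hg 0
  have h1 := congrFun hg 1
  generalize g.1.mulVec v = w at *
  generalize g⁻¹.1 = m at *
  simp only [Matrix.mulVec, dotProduct, Fin.sum_univ_two] at h0 h1
  refine ⟨a * m 0 0 + b * m 1 0, a * m 0 1 + b * m 1 1, ?_⟩
  rw [← hab, ← h0, ← h1]
  ring

/-- `GL_2(A)` acts on the simplices through its action on `A²`. -/
instance simplexAction (n : ℕ) : MulAction (GL (Fin 2) A) (Simplex A n) where
  smul g p := ⟨fun i => (p.line i).map g.1.mulVecLin, by
    obtain ⟨v, h1, h2, h3⟩ := p.exists_vec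
    refine ⟨fun i => g.1.mulVec (v i), fun i => (h1 i).map g, fun i => ?_,
      fun i j hij => (h3 i j hij).map g⟩
    change (p.line i).map g.1.mulVecLin = Submodule.span A {g.1.mulVec (v i)}
    rw [h2, Submodule.map_span, Set.image_singleton]
    rfl⟩
  one_smul p := Simplex.ext <| funext fun i => by
    change (p.line i).map (1 : Matrix (Fin 2) (Fin 2) A).mulVecLin = p.line i
    rw [Matrix.mulVecLin_one, Submodule.map_id]
  mul_smul g h p := Simplex.ext <| funext fun i => by
    change (p.line i).map (g.1 * h.1).mulVecLin = ((p.line i).map h.1.mulVecLin).map g.1.mulVecLin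
    rw [Matrix.mulVecLin_mul, Submodule.map_comp]

theorem face_smul {n : ℕ} (i : Fin (n + 2)) (g : GL (Fin 2) A) (p : Simplex A (n + 1)) :
    face i (g • p) = g • face i p := rfl

theorem scalar_smul {n : ℕ} (a : Aˣ) (p : Simplex A n) :
    Matrix.GeneralLinearGroup.scalar (Fin 2) a • p = p := by
  refine Simplex.ext <| funext fun i => ?_
  have e : (Matrix.GeneralLinearGroup.scalar (Fin 2) a).1.mulVecLin
      = (a : A) • (LinearMap.id : (Fin 2 → A) →ₗ[A] _) := by
    refine LinearMap.ext fun v => ?_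
    simp [Matrix.GeneralLinearGroup.coe_scalar, ← Matrix.smul_one_eq_diagonal]
  change (p.line i).map (Matrix.GeneralLinearGroup.scalar (Fin 2) a).1.mulVecLin = p.line i
  rw [e]
  ext x
  simp only [Submodule.mem_map, LinearMap.smul_apply, LinearMap.id_apply]
  constructor
  · rintro ⟨y, hy, rfl⟩
    exact Submodule.smul_mem _ _ hy
  · intro hx
    exact ⟨(↑a⁻¹ : A) • x, Submodule.smul_mem _ _ hx, by rw [smul_smul, Units.mul_inv, one_smul]⟩

variable (A)

/-- The permutation representation of `GL_2(A)` on `X_n(A²)`. -/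
def XRep (n : ℕ) : Representation ℤ (GL (Fin 2) A) (X A n) where
  toFun g := Finsupp.lmapDomain ℤ ℤ (g • ·)
  map_one' := by ext; simp
  map_mul' g h := by ext; simp [mul_smul]

theorem XRep_single (n : ℕ) (g : GL (Fin 2) A) (p : Simplex A n) (m : ℤ) :
    XRep A n g (Finsupp.single p m) = Finsupp.single (g • p) m := by
  simp [XRep]

theorem XRep_scalar (n : ℕ) (a : Aˣ) :
    XRep A n (Matrix.GeneralLinearGroup.scalar (Fin 2) a) = 1 := by
  refine Finsupp.lhom_ext fun p m => ?_
  rw [XRep_single, scalar_smul, Module.End.one_apply]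

theorem bdry_XRep (n : ℕ) (g : GL (Fin 2) A) (x : X A (n + 1)) :
    bdry A n (XRep A (n + 1) g x) = XRep A n g (bdry A n x) := by
  suffices h : bdry A n ∘ₗ XRep A (n + 1) g = XRep A n g ∘ₗ bdry A n from LinearMap.congr_fun h x
  refine Finsupp.lhom_ext fun p m => ?_
  simp only [bdry, LinearMap.comp_apply, XRep_single, LinearMap.sum_apply, LinearMap.smul_apply,
    Finsupp.lmapDomain_apply, Finsupp.mapDomain_single, face_smul, map_sum, map_smul]

/-- The cycles `Z_2(A²) = ker ∂_2`. -/
def Z₂ : Submodule ℤ (X A 2) := LinearMap.ker (bdry A 1)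

/-- The representation of `GL_2(A)` on `Z_2(A²)`. -/
def ZRep : Representation ℤ (GL (Fin 2) A) (Z₂ A) :=
  (XRep A 2).subrepresentation (Z₂ A) fun g x hx => by
    change bdry A 1 (XRep A 2 g x) = 0
    rw [bdry_XRep, show bdry A 1 x = 0 from hx, map_zero]

theorem ZRep_scalar (a : Aˣ) : ZRep A (Matrix.GeneralLinearGroup.scalar (Fin 2) a) = 1 :=
  LinearMap.ext fun z => Subtype.ext (LinearMap.congr_fun (XRep_scalar A 2 a) z.1)

end Complex

/-! ### Coinvariants of `SL_2(A)` as modules over the square class group -/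

section SquareClasses

variable (A : Type u) [CommRing A]

/-- The square class group `𝒢_A = A^× / (A^×)²`. -/
abbrev SqClass : Type u := Aˣ ⧸ Subgroup.square Aˣ

/-- The group ring `ℤ[𝒢_A]`. -/
abbrev SqRing : Type u := MonoidAlgebra ℤ (SqClass A)

/-- `SL_2(A)`, as the (normal) subgroup of `GL_2(A)` of matrices of determinant `1`. -/
abbrev SLsub : Subgroup (GL (Fin 2) A) := (Matrix.GeneralLinearGroup.det : GL (Fin 2) A →* Aˣ).ker

/-- The matrix `diag(1, a)`, which has determinant `a`. -/
def diagUnit : Aˣ →* GL (Fin 2) A where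
  toFun a := ⟨!![1, 0; 0, (a : A)], !![1, 0; 0, ((a⁻¹ : Aˣ) : A)],
    by simp [Matrix.one_fin_two],
    by simp [Matrix.one_fin_two]⟩
  map_one' := by ext i j; fin_cases i <;> fin_cases j <;> simp
  map_mul' a b := by ext i j; fin_cases i <;> fin_cases j <;> simp [Matrix.mul_apply]

theorem det_diagUnit (a : Aˣ) : Matrix.GeneralLinearGroup.det (diagUnit A a) = a := by
  ext; simp [diagUnit]

variable {A} {V : Type u} [AddCommGroup V] (ρ : Representation ℤ (GL (Fin 2) A) V)

/-- The coinvariants `H_0(SL_2(A), V)` of a `GL_2(A)`-module `V`. -/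
abbrev H0SL : Type u :=
  Representation.Coinvariants (MonoidHom.comp ρ (SLsub A).subtype)

theorem toCoinvariants_eq_one_of_det {g : GL (Fin 2) A}
    (hg : Matrix.GeneralLinearGroup.det g = 1) : ρ.toCoinvariants (SLsub A) g = 1 :=
  LinearMap.ext fun x => Representation.Coinvariants.induction_on x fun v =>
    Representation.Coinvariants.mk_self_apply (MonoidHom.comp ρ (SLsub A).subtype) ⟨g, hg⟩ v

theorem toCoinvariants_eq_of_det {g h : GL (Fin 2) A}
    (e : Matrix.GeneralLinearGroup.det g = Matrix.GeneralLinearGroup.det h) :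
    ρ.toCoinvariants (SLsub A) g = ρ.toCoinvariants (SLsub A) h := by
  have h1 := toCoinvariants_eq_one_of_det ρ (g := g * h⁻¹) (by rw [map_mul, map_inv, e]; simp)
  calc _ = ρ.toCoinvariants (SLsub A) (g * h⁻¹ * h) := by rw [inv_mul_cancel_right]
    _ = _ := by rw [map_mul, h1, one_mul]

/-- If scalar matrices act trivially on `V`, then `𝒢_A ≃ PGL_2(A) / PSL_2(A)` acts on
`H_0(SL_2(A), V)`: the class `⟨a⟩` acts through any matrix of determinant `a`
(see `sqRep_det`). -/
def sqRep (hρ : ∀ a : Aˣ, ρ (Matrix.GeneralLinearGroup.scalar (Fin 2) a) = 1) :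
    Representation ℤ (SqClass A) (H0SL ρ) :=
  QuotientGroup.lift (Subgroup.square Aˣ) ((ρ.toCoinvariants (SLsub A)).comp (diagUnit A)) (by
    rintro _ ⟨a, rfl⟩
    change ρ.toCoinvariants (SLsub A) (diagUnit A (a * a)) = 1
    rw [toCoinvariants_eq_of_det ρ (h := Matrix.GeneralLinearGroup.scalar (Fin 2) a)
      (by rw [det_diagUnit, Matrix.GeneralLinearGroup.det_scalar, Fintype.card_fin, sq])]
    refine LinearMap.ext fun x => Representation.Coinvariants.induction_on x fun v => ?_
    rw [Representation.toCoinvariants_mk, hρ]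
    rfl)

theorem sqRep_det (hρ : ∀ a : Aˣ, ρ (Matrix.GeneralLinearGroup.scalar (Fin 2) a) = 1)
    (g : GL (Fin 2) A) (v : V) :
    sqRep ρ hρ (QuotientGroup.mk (Matrix.GeneralLinearGroup.det g))
      (Representation.Coinvariants.mk _ v) = Representation.Coinvariants.mk _ (ρ g v) := by
  change ρ.toCoinvariants (SLsub A) (diagUnit A (Matrix.GeneralLinearGroup.det g)) _ = _
  rw [toCoinvariants_eq_of_det ρ (det_diagUnit A _), Representation.toCoinvariants_mk]

end SquareClasses

/-! ### The refined scissors congruence group -/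

section Scissors

variable (A : Type u) [CommRing A]

/-- The action of `𝒢_A` on `H_0(SL_2(A), Z_2(A²))`. -/
def RPRep : Representation ℤ (SqClass A) (H0SL (ZRep A)) := sqRep (ZRep A) (ZRep_scalar A)

/-- The action of `𝒢_A` on `H_0(SL_2(A), X_2(A²))`. -/
def X2Rep : Representation ℤ (SqClass A) (H0SL (XRep A 2)) := sqRep (XRep A 2) (XRep_scalar A 2)

/-- `ℛ𝒫(A) = H_0(SL_2(A), Z_2(A²))`, as a `ℤ[𝒢_A]`-module. -/
abbrev RP : Type u := (RPRep A).asModule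

/-- `H_0(SL_2(A), X_2(A²))`, as a `ℤ[𝒢_A]`-module (it is free of rank one). -/
abbrev H0X2 : Type u := (X2Rep A).asModule

/-- The map `H_0(SL_2(A), Z_2(A²)) → H_0(SL_2(A), X_2(A²))` induced by the inclusion. -/
def lambdaInt : (RPRep A).IntertwiningMap (X2Rep A) where
  toLinearMap := Representation.Coinvariants.map _ _
    { toLinearMap := (Z₂ A).subtype
      isIntertwining' := fun _ => rfl }
  isIntertwining' g := by
    obtain ⟨a, rfl⟩ := QuotientGroup.mk_surjective g
    refine LinearMap.ext fun x => Representation.Coinvariants.induction_on x fun v => ?_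
    rfl

/-- `λ : ℛ𝒫(A) → H_0(SL_2(A), X_2(A²))`, as a `ℤ[𝒢_A]`-linear map. -/
def lambda : RP A →ₗ[SqRing A] H0X2 A :=
  Representation.IntertwiningMap.equivLinearMapAsModule _ _ (lambdaInt A)

/-- The refined scissors congruence group `ℛ𝒫_1(A) = ker λ`. -/
abbrev RP₁ : Submodule (SqRing A) (RP A) := LinearMap.ker (lambda A)

variable {A}

theorem isBasisPair_of_isUnit {v w : Fin 2 → A} (h : IsUnit (v 0 * w 1 - w 0 * v 1)) :
    IsBasisPair v w := by
  rw [IsBasisPair, (Pi.basisFun A (Fin 2)).is_basis_iff_det, Module.Basis.det_apply,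
    Matrix.det_fin_two]
  simpa [Module.Basis.toMatrix_apply] using h

/-- The `2`-simplex spanned by three vectors. -/
def simplexOfVec (v : Fin 3 → Fin 2 → A) (h : ∀ i, Unimodular (v i))
    (h' : ∀ i j, i ≠ j → IsUnit (v i 0 * v j 1 - v j 0 * v i 1)) : Simplex A 2 where
  line i := Submodule.span A {v i}
  exists_vec := ⟨v, h, fun _ => rfl, fun i j hij => isBasisPair_of_isUnit (h' i j hij)⟩

/-- The simplex `(∞, 0, a)`, where `∞ = ⟨e₁⟩`, `0 = ⟨e₂⟩` and `a = ⟨e₁ + a e₂⟩`. -/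
def triInfZero (a : Aˣ) : Simplex A 2 :=
  simplexOfVec ![![1, 0], ![0, 1], ![1, (a : A)]]
    (by
      intro i
      fin_cases i
      · exact ⟨1, 0, by simp⟩
      · exact ⟨0, 1, by simp⟩
      · exact ⟨1, 0, by simp⟩)
    (by intro i j hij; fin_cases i <;> fin_cases j <;> simp at hij ⊢)

/-- The simplex `(0, ∞, a)`. -/
def triZeroInf (a : Aˣ) : Simplex A 2 :=
  simplexOfVec ![![0, 1], ![1, 0], ![1, (a : A)]]
    (by
      intro i
      fin_cases i
      · exact ⟨0, 1, by simp⟩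
      · exact ⟨1, 0, by simp⟩
      · exact ⟨1, 0, by simp⟩)
    (by intro i j hij; fin_cases i <;> fin_cases j <;> simp at hij ⊢)

/-- The chain `(∞, 0, a) + (0, ∞, a) - (∞, 0, 1) - (0, ∞, 1)`. -/
def psiChain (a : Aˣ) : X A 2 :=
  Finsupp.single (triInfZero a) 1 + Finsupp.single (triZeroInf a) 1
    - Finsupp.single (triInfZero 1) 1 - Finsupp.single (triZeroInf 1) 1

theorem psiChain_mem (a : Aˣ) : psiChain a ∈ Z₂ A := by
  have h1 : ∀ b : Aˣ, face 0 (triInfZero b) = face 1 (triZeroInf b) := fun b => by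
    ext i : 2; fin_cases i <;> rfl
  have h2 : ∀ b : Aˣ, face 1 (triInfZero b) = face 0 (triZeroInf b) := fun b => by
    ext i : 2; fin_cases i <;> rfl
  have h3 : face 2 (triInfZero a) = face 2 (triInfZero 1) := by
    ext i : 2; fin_cases i <;> rfl
  have h4 : face 2 (triZeroInf a) = face 2 (triZeroInf 1) := by
    ext i : 2; fin_cases i <;> rfl
  change bdry A 1 _ = 0
  have hb : ∀ p : Simplex A 2, bdry A 1 (Finsupp.single p 1) =
      Finsupp.single (face 0 p) 1 - Finsupp.single (face 1 p) 1 + Finsupp.single (face 2 p) 1 := by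
    intro p
    rw [bdry, LinearMap.sum_apply, Fin.sum_univ_three]
    simp [sub_eq_add_neg]
  simp only [psiChain, map_sub, map_add, hb, h1, h2, h3, h4]
  abel

/-- The element `ψ_1(a) = (∞, 0, a) + (0, ∞, a) - (∞, 0, 1) - (0, ∞, 1)` of `ℛ𝒫(A)`. -/
def psi (a : Aˣ) : RP A :=
  (RPRep A).asModuleEquiv.symm (Representation.Coinvariants.mk _ ⟨psiChain a, psiChain_mem a⟩)

/-- The matrix `w` with rows `(0, 1)` and `(-1, 0)`. -/
def wMat : GL (Fin 2) A :=
  ⟨!![0, 1; -1, 0], !![0, -1; 1, 0], by simp [Matrix.one_fin_two], by simp [Matrix.one_fin_two]⟩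

theorem det_wMat : Matrix.GeneralLinearGroup.det (wMat : GL (Fin 2) A) = 1 := by
  ext; simp [wMat]

theorem wMat_smul (a b : Aˣ) (h : (b : A) * a = -1) :
    (wMat : GL (Fin 2) A) • triInfZero a = triZeroInf b := by
  have hm : ∀ v w : Fin 2 → A, ∀ c : Aˣ, (wMat : GL (Fin 2) A).1.mulVec v = (c : A) • w →
      (Submodule.span A {v}).map (wMat : GL (Fin 2) A).1.mulVecLin = Submodule.span A {w} := by
    intro v w c e
    rw [Submodule.map_span, Set.image_singleton, Matrix.mulVecLin_apply, e]
    exact Submodule.span_singleton_smul_eq c.isUnit w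
  ext i : 2
  fin_cases i
  · exact hm ![1, 0] ![0, 1] (-1)
      (by
        funext j
        fin_cases j <;> simp [wMat, Matrix.mulVec, dotProduct])
  · exact hm ![0, 1] ![1, 0] 1
      (by
        funext j
        fin_cases j <;> simp [wMat, Matrix.mulVec, dotProduct])
  · exact hm ![1, (a : A)] ![1, (b : A)] a
      (by
        funext j
        fin_cases j <;> simp [wMat, Matrix.mulVec, dotProduct, mul_comm, ← h])

theorem psi_neg_one_mem : psi (-1 : Aˣ) ∈ RP₁ A := by
  change Representation.Coinvariants.mk (MonoidHom.comp (XRep A 2) (SLsub A).subtype)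
    (psiChain (-1)) = 0
  have key : ∀ a b : Aˣ, (b : A) * a = -1 →
      Representation.Coinvariants.mk (MonoidHom.comp (XRep A 2) (SLsub A).subtype)
        (Finsupp.single (triZeroInf b) 1) =
      Representation.Coinvariants.mk (MonoidHom.comp (XRep A 2) (SLsub A).subtype)
        (Finsupp.single (triInfZero a) 1) := fun a b h => by
    rw [← wMat_smul a b h, ← XRep_single]
    exact Representation.Coinvariants.mk_self_apply
      (MonoidHom.comp (XRep A 2) (SLsub A).subtype) ⟨wMat, det_wMat⟩ _
  simp only [psiChain, map_sub, map_add, key 1 (-1) (by simp), key (-1) 1 (by simp)]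
  abel

variable (A)

/-- The element `ψ_1(-1)` of `ℛ𝒫_1(A)`. -/
def psiNegOne : RP₁ A := ⟨psi (-1), psi_neg_one_mem⟩

end Scissors

/-! ### Subgroups of `PSL_2(A)` and relative homology

`PSL(2, A)` is `SL(2, A)` modulo its centre, and the centre consists of the scalar matrices `a I`
with `a² = 1` (`Matrix.SpecialLinearGroup.mem_center_iff`). -/

section Groups

variable (A : Type u) [CommRing A]

/-- The group of diagonal matrices in `SL_2(A)`, that is `diag(a, a⁻¹)` with `a ∈ A^×`. -/
def T : Subgroup SL(2, A) where
  carrier := {M | M 0 1 = 0 ∧ M 1 0 = 0}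
  one_mem' := by simp
  mul_mem' := by
    rintro M N ⟨h1, h2⟩ ⟨h3, h4⟩
    simp [Matrix.mul_apply, Fin.sum_univ_two, h1, h2, h3, h4]
  inv_mem' := by
    rintro M ⟨h1, h2⟩
    rw [Set.mem_ofPred_eq, Matrix.SpecialLinearGroup.SL2_inv_expl]
    simp [h1, h2]

/-- The group of upper triangular matrices in `SL_2(A)`. -/
def B : Subgroup SL(2, A) where
  carrier := {M | M 1 0 = 0}
  one_mem' := by simp
  mul_mem' := by
    rintro M N (h1 : M 1 0 = 0) (h2 : N 1 0 = 0)
    simp [Matrix.mul_apply, Fin.sum_univ_two, h1, h2]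
  inv_mem' := by
    rintro M (h1 : M 1 0 = 0)
    rw [Set.mem_ofPred_eq, Matrix.SpecialLinearGroup.SL2_inv_expl]
    simp [h1]

/-- The group of monomial matrices in `SL_2(A)`: the matrices with diagonal `(a, a⁻¹)` and zeros
off the diagonal, and those with antidiagonal `(a, -a⁻¹)` and zeros on the diagonal. -/
def SM : Subgroup SL(2, A) where
  carrier := {M | (M 0 1 = 0 ∧ M 1 0 = 0) ∨ (M 0 0 = 0 ∧ M 1 1 = 0)}
  one_mem' := by simp
  mul_mem' := by
    rintro M N (⟨h1, h2⟩ | ⟨h1, h2⟩) (⟨h3, h4⟩ | ⟨h3, h4⟩) <;>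
    simp [Matrix.mul_apply, Fin.sum_univ_two, h1, h2, h3, h4]
  inv_mem' := by
    intro M hM
    rw [Set.mem_ofPred_eq, Matrix.SpecialLinearGroup.SL2_inv_expl]
    rcases hM with ⟨h1, h2⟩ | ⟨h1, h2⟩ <;> simp [h1, h2]

/-- The image in `PSL_2(A)` of a subgroup of `SL_2(A)`. -/
def proj (H : Subgroup SL(2, A)) : Subgroup PSL(2, A) :=
  H.map (QuotientGroup.mk' (Subgroup.center SL(2, A)))

/-- `PT(A)`, the diagonal matrices modulo `μ_2(A) I`. -/
abbrev PT : Subgroup PSL(2, A) := proj A (T A)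

/-- `PB(A)`, the upper triangular matrices modulo `μ_2(A) I`. -/
abbrev PB : Subgroup PSL(2, A) := proj A (B A)

/-- `PSM_2(A)`, the monomial matrices modulo `μ_2(A) I`. -/
abbrev PSM : Subgroup PSL(2, A) := proj A (SM A)

theorem PT_le_PB : PT A ≤ PB A := Subgroup.map_mono fun _ h => h.2

end Groups

section Homology

/-- The integers with trivial action of `G`, in the universe of `G`. -/
abbrev trivZ (G : Type u) [Group G] : Rep (ULift.{u} ℤ) G :=
  Rep.trivial (ULift.{u} ℤ) G (ULift.{u} ℤ)

variable {G H : Type u} [Group G] [Group H]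

/-- The chain map between the complexes of inhomogeneous (bar) chains with coefficients in `ℤ`
induced by a homomorphism of groups. -/
def chainsMapZ (f : H →* G) : groupHomology.inhomogeneousChains (trivZ H) ⟶
    groupHomology.inhomogeneousChains (trivZ G) :=
  groupHomology.chainsMap (A := trivZ H) (B := trivZ G) f (𝟙 (trivZ H))

/-- The map `H_n(H, ℤ) → H_n(G, ℤ)` induced by a homomorphism of groups. -/
def homologyMapZ (f : H →* G) (n : ℕ) :
    groupHomology (trivZ H) n ⟶ groupHomology (trivZ G) n :=
  groupHomology.map (A := trivZ H) (B := trivZ G) f (𝟙 (trivZ H)) n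

/-- The relative homology `H_n(G, K; ℤ)` of a group `G` modulo a subgroup `K`: the homology of the
quotient of the chain complex of `G` by the chain complex of `K`. -/
abbrev relHomology (K : Subgroup G) (n : ℕ) : ModuleCat (ULift.{u} ℤ) :=
  (Limits.cokernel (chainsMapZ K.subtype)).homology n

end Homology

end RefinedScissors

end

open CategoryTheory
open scoped MatrixGroups

noncomputable section

/-! ### Permutation representations and their homology -/

namespace PermRep

variable {k G : Type u} [CommRing k] [Group G]

/-! Write G = PSL_2(A) and let a triple, an edge and a line be a simplex of dimension 2, 1 and 0.
The group G acts transitively on edges and on lines; PT and PB are the stabilizers of the edge (∞,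
0) and of its first line, and G/PSM is the set of unordered edges. The relative group is computed by
three dimension shifts, and the resulting coinvariants are then compared with RP.

Shifts. By Shapiro's lemma, H_3(G, PSM) = H_2(G, I), with I the augmentation kernel of ℤ[G/PSM]
(`relHomology_iso`). Let N be the kernel of ℤ[edges] → ℤ[lines], an edge going to its first line.
The hypothesis on PT ⊆ PB, with injectivity on H_1 from the retraction PB → PT, makes H_1(G, N) and
H_2(G, N) vanish. Forgetting orientations maps N onto I, by exactness at X_0, so H_2(G, I) = H_1(G,
Q) with Q the kernel of N → I. Exactness at X_1 shows that x ↦ ∂x - swap ∂x maps X_2 onto Q. Since G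
acts freely on triples, H_1(G, X_2) = 0, so H_1(G, Q) is the kernel of P_G → (X_2)_G, where P
consists of the 2-chains whose boundary is invariant under `swap` (`relHomology_PSM_equiv`).

Comparison. P contains Z_2, and swap-invariant edge chains are combinations of e + swap e, indexed
by G/PSM. Each e + swap e bounds a translate of (∞, 0, 1) + (0, ∞, 1); subtracting such fillings
retracts P onto Z_2. The retraction is not equivariant: its defect comes from moving (∞, 0, 1) + (0,
∞, 1) by elements of PSM, which gives classes ψ(b) in the submodule generated by ψ(-1). Hence the
kernel of RP → P_G is exactly that submodule (`fromRP_eq_zero_iff`). Modulo the image of RP, P_G is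
generated by the class of the one filling, and counting coefficients excludes it from the kernel of
P_G → (X_2)_G (`exists_fromRP`). Restricting to RP_1 gives the isomorphism. -/

theorem shortExact_mk {X Y Z : Rep.{u} k G} (f : X ⟶ Y) (g : Y ⟶ Z)
    (hf : Function.Injective f.hom) (hg : Function.Surjective g.hom)
    (h : Function.Exact f.hom g.hom) :
    (ShortComplex.mk f g (by ext x; exact h.apply_apply_eq_zero x)).ShortExact where
  exact := by
    refine (ShortComplex.exact_map_iff_of_faithful _ (forget₂ (Rep k G) (ModuleCat k))).1 ?_
    rw [ShortComplex.moduleCat_exact_iff]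
    intro x hx
    exact (h x).1 hx
  mono_f := (Rep.mono_iff_injective f).2 hf
  epi_g := (Rep.epi_iff_surjective g).2 hg

/-- The kernel of a morphism of representations. -/
abbrev ker {X Y : Rep.{u} k G} (f : X ⟶ Y) : Rep.{u} k G :=
  X.subrepresentation (LinearMap.ker f.hom.toLinearMap) fun g x hx => by
    change f.hom (X.ρ g x) = 0
    rw [Rep.hom_comm_apply, show f.hom x = 0 from hx, map_zero]

/-- The inclusion of the kernel. -/
abbrev kerι {X Y : Rep.{u} k G} (f : X ⟶ Y) : ker f ⟶ X := Rep.subtype X _ _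

theorem exact_kerι {X Y : Rep.{u} k G} (f : X ⟶ Y) : Function.Exact (kerι f).hom f.hom :=
  fun x => ⟨fun hx => ⟨⟨x, hx⟩, rfl⟩, by rintro ⟨y, rfl⟩; exact y.2⟩

/-- A morphism which is killed by `g` factors through the kernel of `g`. -/
def kerLift {X Y Z : Rep.{u} k G} (g : Y ⟶ Z) (f : X ⟶ Y) (h : ∀ x, g.hom (f.hom x) = 0) :
    X ⟶ ker g :=
  Rep.ofHom (ρ := X.ρ)
    { toLinearMap := f.hom.toLinearMap.codRestrict _ h
      isIntertwining' a := LinearMap.ext fun x => Subtype.ext (Rep.hom_comm_apply f a x) }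

theorem shortExact_ker {X Y : Rep.{u} k G} (f : X ⟶ Y) (hf : Function.Surjective f.hom) :
    (ShortComplex.mk (kerι f) f (by ext x; exact x.2)).ShortExact :=
  shortExact_mk _ _ Subtype.val_injective hf (exact_kerι f)

section Perm

variable (Ω : Type u) [MulAction G Ω] (M : Rep.{u} k G)

/-- The representation on finitely supported functions from a `G`-set to a representation. -/
def permRho : Representation k G (Ω →₀ M) where
  toFun g := Finsupp.mapRange.linearMap (M.ρ g) ∘ₗ Finsupp.lmapDomain M k (g • ·)
  map_one' := by ext; simp
  map_mul' g h := by ext; simp [mul_smul]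

/-- The representation on finitely supported functions from a `G`-set to a representation. -/
abbrev perm : Rep.{u} k G := Rep.of (permRho Ω M)

variable {Ω M}

@[simp]
theorem permRho_single (g : G) (x : Ω) (m : M) :
    permRho Ω M g (Finsupp.single x m) = Finsupp.single (g • x) (M.ρ g m) := by
  simp [permRho]

/-- Morphisms out of a permutation representation. -/
def permLift {V : Rep.{u} k G} (f : Ω → M →ₗ[k] V)
    (hf : ∀ (g : G) x m, f (g • x) (M.ρ g m) = V.ρ g (f x m)) : perm Ω M ⟶ V :=
  Rep.ofHom (σ := V.ρ)
    { toLinearMap := Finsupp.lsum k f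
      isIntertwining' g := by
        refine Finsupp.lhom_ext fun x m => ?_
        simpa using hf g x m }

theorem permLift_apply {V : Rep.{u} k G} (f : Ω → M →ₗ[k] V)
    (hf : ∀ (g : G) x m, f (g • x) (M.ρ g m) = V.ρ g (f x m)) (v : Ω →₀ M) :
    (permLift f hf).hom v = Finsupp.lsum k f v := rfl

@[simp]
theorem permLift_single {V : Rep.{u} k G} (f : Ω → M →ₗ[k] V)
    (hf : ∀ (g : G) x m, f (g • x) (M.ρ g m) = V.ρ g (f x m)) (x : Ω) (m : M) :
    (permLift f hf).hom (Finsupp.single x m) = f x m := by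
  exact (permLift_apply f hf _).trans (by simp)

variable (M) in
/-- The map of permutation representations induced by an equivariant map. -/
def permMap {Ω' : Type u} [MulAction G Ω'] (f : Ω → Ω') (hf : ∀ (g : G) x, f (g • x) = g • f x) :
    perm Ω M ⟶ perm Ω' M :=
  permLift (V := perm Ω' M) (fun x => Finsupp.lsingle (f x)) fun g x m => by
    simp [hf]

theorem permMap_eq_mapDomain {Ω' : Type u} [MulAction G Ω'] (f : Ω → Ω')
    (hf : ∀ (g : G) x, f (g • x) = g • f x) (v : Ω →₀ M) :
    (permMap M f hf).hom v = (Finsupp.mapDomain f v) := rfl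

@[simp]
theorem permMap_single {Ω' : Type u} [MulAction G Ω'] (f : Ω → Ω')
    (hf : ∀ (g : G) x, f (g • x) = g • f x) (x : Ω) (m : M) :
    (permMap M f hf).hom (Finsupp.single x m) = (Finsupp.single (f x) m) := by
  exact (permMap_eq_mapDomain f hf _).trans (by simp)

theorem permMap_surjective {Ω' : Type u} [MulAction G Ω'] (f : Ω → Ω')
    (hf : ∀ (g : G) x, f (g • x) = g • f x) (h : Function.Surjective f) :
    Function.Surjective (permMap M f hf).hom :=
  Finsupp.mapDomain_surjective h

variable (Ω M) in
/-- The augmentation of a permutation representation. -/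
def permSum : perm Ω M ⟶ M := permLift (fun _ => LinearMap.id) fun _ _ _ => rfl

@[simp]
theorem permSum_single (x : Ω) (m : M) :
    (permSum Ω M).hom (Finsupp.single x m) = m := permLift_single _ _ _ _

theorem permSum_mapDomain {Ω' : Type u} [MulAction G Ω'] (f : Ω → Ω') (v : Ω →₀ M) :
    (permSum Ω' M).hom (Finsupp.mapDomain f v) = (permSum Ω M).hom v := by
  induction v using Finsupp.induction_linear with
  | zero => simp
  | add x y hx hy => rw [Finsupp.mapDomain_add, map_add, map_add, hx, hy]
  | single x m =>
    rw [Finsupp.mapDomain_single]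
    exact (permSum_single (f x) m).trans (permSum_single x m).symm

theorem permSum_surjective [Nonempty Ω] : Function.Surjective (permSum Ω M).hom :=
  fun m => ⟨(Finsupp.single (Classical.arbitrary Ω) m), permSum_single _ _⟩

variable (Ω) in
/-- Functoriality of permutation representations in the coefficients. -/
def permCoeff {M' : Rep.{u} k G} (f : M ⟶ M') : perm Ω M ⟶ perm Ω M' :=
  permLift (V := perm Ω M') (fun x => Finsupp.lsingle x ∘ₗ f.hom.toLinearMap) fun g x m => by
    simp [Rep.hom_comm_apply]

theorem permCoeff_single {M' : Rep.{u} k G} (f : M ⟶ M') (x : Ω) (m : M) :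
    (permCoeff Ω f).hom (Finsupp.single x m) = (Finsupp.single x (f.hom m)) :=
  permLift_single _ _ _ _

theorem permCoeff_toLinearMap {M' : Rep.{u} k G} (f : M ⟶ M') :
    (permCoeff Ω f).hom.toLinearMap = Finsupp.mapRange.linearMap f.hom.toLinearMap := by
  refine Finsupp.lhom_ext fun x m => ?_
  exact (permLift_single _ _ _ _).trans (by simp)

theorem permCoeff_eq_mapRange {M' : Rep.{u} k G} (f : M ⟶ M') (v : Ω →₀ M) :
    (permCoeff Ω f).hom v = (Finsupp.mapRange f.hom (map_zero _) v : Ω →₀ M') :=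
  LinearMap.congr_fun (permCoeff_toLinearMap f) v

theorem permCoeff_comp {X Y Z : Rep.{u} k G} (f : X ⟶ Y) (g : Y ⟶ Z) :
    permCoeff Ω (f ≫ g) = permCoeff Ω f ≫ permCoeff Ω g := by
  ext1
  refine Representation.IntertwiningMap.ext (Finsupp.lhom_ext fun x m => ?_)
  refine (permCoeff_single (f ≫ g) x m).trans (Eq.symm ?_)
  exact (congrArg (permCoeff Ω g).hom (permCoeff_single f x m)).trans (permCoeff_single g x _)

theorem permCoeff_zero {X Y : Rep.{u} k G} : permCoeff Ω (0 : X ⟶ Y) = 0 := by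
  ext1
  refine Representation.IntertwiningMap.ext (Finsupp.lhom_ext fun x m => ?_)
  exact (permCoeff_single (0 : X ⟶ Y) x m).trans (Finsupp.single_zero x)

/-- Exactness is checked pointwise. It keeps the dimension shifting sequence of M exact after
passing to Ω →₀ M, as the inductive step of Shapiro's lemma needs. -/
theorem shortExact_permCoeff {X Y Z : Rep.{u} k G} (f : X ⟶ Y) (g : Y ⟶ Z)
    (hf : Function.Injective f.hom) (hg : Function.Surjective g.hom)
    (h : Function.Exact f.hom g.hom) :
    (ShortComplex.mk (permCoeff Ω f) (permCoeff Ω g) (by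
      rw [← permCoeff_comp, show f ≫ g = 0 by ext x; exact h.apply_apply_eq_zero x,
        permCoeff_zero])).ShortExact := by
  refine shortExact_mk _ _ (fun v w hvw => ?_) (fun v => ?_) (fun v => ?_)
  · rw [permCoeff_eq_mapRange, permCoeff_eq_mapRange] at hvw
    exact Finsupp.mapRange_injective _ (map_zero _) hf hvw
  · obtain ⟨w, hw⟩ := Finsupp.mapRange_surjective _ (map_zero _) hg v
    exact ⟨w, (permCoeff_eq_mapRange g w).trans hw⟩
  · have hr := Finsupp.range_mapRange_linearMap (I := Ω) f.hom.toLinearMap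
      (LinearMap.ker_eq_bot.2 hf)
    have hk := Finsupp.ker_mapRange (I := Ω) g.hom.toLinearMap
    have e : LinearMap.range f.hom.toLinearMap = LinearMap.ker g.hom.toLinearMap :=
      ((LinearMap.exact_iff (f := f.hom.toLinearMap) (g := g.hom.toLinearMap)).1 h).symm
    rw [e, ← hk, ← permCoeff_toLinearMap, ← permCoeff_toLinearMap] at hr
    exact (SetLike.ext_iff.1 hr v).symm

end Perm

end PermRep

/-! ### Vanishing of positive-degree homology by a contracting homotopy -/

namespace PermRep

variable {k G : Type u} [CommRing k] [Group G]

section Vanishing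

variable (V : Rep.{u} k G)

/-- Prepend `u⁻¹` to a chain supported on `g`, for each `u` in the support of `y`. -/
def prepend {n : ℕ} (g : Fin n → G) : (G →₀ V) →ₗ[k] ((Fin (n + 1) → G) →₀ V) :=
  Finsupp.lsum k fun u => Finsupp.lsingle (Fin.cons u⁻¹ g) ∘ₗ V.ρ u⁻¹

theorem prepend_single {n : ℕ} (g : Fin n → G) (u : G) (v : V) :
    prepend V g (Finsupp.single u v) = Finsupp.single (Fin.cons u⁻¹ g) (V.ρ u⁻¹ v) := by
  simp [prepend]

theorem contractNth_zero_cons {n : ℕ} (x : G) (g : Fin (n + 1) → G) :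
    Fin.contractNth 0 (· * ·) (Fin.cons x g : Fin (n + 2) → G) =
      Fin.cons (x * g 0) fun i => g i.succ := by
  funext i
  refine Fin.cases ?_ (fun i => ?_) i
  · rw [Fin.contractNth_apply_of_eq _ _ _ _ rfl]; rfl
  · rw [Fin.contractNth_apply_of_gt _ _ _ _ (by simp)]; rfl

theorem contractNth_succ_cons {n : ℕ} (x : G) (g : Fin (n + 1) → G) (j : Fin (n + 1)) :
    Fin.contractNth j.succ (· * ·) (Fin.cons x g : Fin (n + 2) → G) =
      Fin.cons x (Fin.contractNth j (· * ·) g) := by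
  funext i
  refine Fin.cases ?_ (fun i => ?_) i
  · rw [Fin.contractNth_apply_of_lt _ _ _ _ (by simp)]; rfl
  · rcases lt_trichotomy (i : ℕ) j with h | h | h
    · rw [Fin.contractNth_apply_of_lt _ _ _ _ (by simpa using h), Fin.cons_succ,
        Fin.contractNth_apply_of_lt _ _ _ _ h]; rfl
    · rw [Fin.contractNth_apply_of_eq _ _ _ _ (by simpa using h), Fin.cons_succ, Fin.cons_succ,
        Fin.contractNth_apply_of_eq _ _ _ _ h]; rfl
    · rw [Fin.contractNth_apply_of_gt _ _ _ _ (by simpa using h), Fin.cons_succ, Fin.cons_succ,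
        Fin.contractNth_apply_of_gt _ _ _ _ h]

/-- The homotopy identity behind the vanishing theorem. In the boundary of the prepended chain, the
first face acts by u on ρ(u⁻¹)v and returns v over g, summing to the augmentation of y. The next
face turns u⁻¹ into u⁻¹ g₀ = (g₀⁻¹u)⁻¹, which is prepending the translate of y by g₀⁻¹. The
remaining faces do not touch the new entry and match the faces of g with opposite sign. -/
theorem d_prepend {n : ℕ} (g : Fin (n + 1) → G) (y : G →₀ V) :
    groupHomology.inhomogeneousChains.d V (n + 1) (prepend V g y) +
      (prepend V (fun i => g i.succ) (permRho G V (g 0)⁻¹ y) +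
        ∑ j : Fin (n + 1), (-1 : k) ^ ((j : ℕ) + 1) •
          prepend V (Fin.contractNth j (· * ·) g) y) =
      Finsupp.single g ((permSum G V).hom y) := by
  induction y using Finsupp.induction_linear with
  | zero => simp
  | add x y hx hy =>
    simp only [map_add, smul_add, Finset.sum_add_distrib, Finsupp.single_add] at hx hy ⊢
    rw [← hx, ← hy]
    abel
  | single u v =>
    rw [permSum_single, permRho_single]
    simp only [prepend_single]
    rw [groupHomology.inhomogeneousChains.d_single, Fin.sum_univ_succ, contractNth_zero_cons]
    simp only [contractNth_succ_cons, Fin.cons_succ, Fin.cons_zero, Fin.val_succ, Fin.val_zero,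
      pow_succ _ (_ + 1), mul_neg, mul_one, neg_smul, Finset.sum_neg_distrib, zero_add, pow_one,
      one_smul, smul_eq_mul, mul_inv_rev, inv_inv, map_mul, Module.End.mul_apply,
      Representation.self_inv_apply]
    simp
    abel

variable {V}

/-- The positive degree homology of a representation vanishes if the augmentation from
`G →₀ V` is a split epimorphism of representations. -/
theorem isZero_groupHomology_succ (φ : V ⟶ perm G V) (hφ : φ ≫ permSum G V = 𝟙 V) (n : ℕ) :
    Limits.IsZero (groupHomology V (n + 1)) := by
  have hφ' : ∀ v, (permSum G V).hom (φ.hom v) = v := fun v => congr($(hφ).hom v)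
  refine (HomologicalComplex.exactAt_iff_isZero_homology _ _).1 ?_
  rw [HomologicalComplex.exactAt_iff' _ (n + 2) (n + 1) n (by simp) (by simp),
    ShortComplex.moduleCat_exact_iff]
  intro x hx
  -- The section φ spreads each coefficient over G before prepending. Its equivariance matches the
  -- translate of y in `d_prepend` with the first term of the differential, so h is a contracting
  -- homotopy.
  let h : ∀ m, ((Fin m → G) →₀ V) →ₗ[k] ((Fin (m + 1) → G) →₀ V) := fun m =>
    Finsupp.lsum k fun g => prepend V g ∘ₗ φ.hom.toLinearMap
  have key : ∀ x : (Fin (n + 1) → G) →₀ V,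
      groupHomology.inhomogeneousChains.d V (n + 1) (h _ x) +
        h _ (groupHomology.inhomogeneousChains.d V n x) = x := by
    intro x
    induction x using Finsupp.induction_linear with
    | zero => simp
    | add x y hx hy => rw [map_add, map_add, map_add, map_add, add_add_add_comm, hx, hy]
    | single g v =>
      have hs : ∀ {m} (g : Fin m → G) v, h m (Finsupp.single g v) = prepend V g (φ.hom v) :=
        fun g v => by simp [h]
      rw [groupHomology.inhomogeneousChains.d_single, map_add, map_sum]
      simp only [map_smul, hs]
      rw [Rep.hom_comm_apply]
      exact (d_prepend V g (φ.hom v)).trans (by rw [hφ'])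
  refine ⟨h _ x, ?_⟩
  have hx' : groupHomology.inhomogeneousChains.d V n x = 0 := by
    rw [← groupHomology.inhomogeneousChains.d_def]; exact hx
  have := key x
  rw [hx', map_zero, add_zero, ← groupHomology.inhomogeneousChains.d_def] at this
  exact this

end Vanishing

end PermRep

/-! ### Shapiro's lemma for transitive G-sets -/

namespace PermRep

variable {k G : Type u} [CommRing k] [Group G]

theorem H0π_eq_zero_iff (M : Rep.{u} k G) (m : M) :
    groupHomology.H0π M m = 0 ↔ Representation.Coinvariants.mk M.ρ m = 0 := by
  have h1 := congr($(groupHomology.H0π_comp_H0Iso_hom M) m)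
  have h2 := congr($(groupHomology.coinvariantsMk_comp_H0Iso_inv M) m)
  constructor
  · intro h
    change (groupHomology.H0Iso M).hom (groupHomology.H0π M m) = _ at h1
    rw [h, map_zero] at h1
    exact h1.symm
  · intro h
    rw [← h2]
    change (groupHomology.H0Iso M).inv (Representation.Coinvariants.mk M.ρ m) = 0
    rw [h, map_zero]

section Shapiro

variable {S : Subgroup G} {Ω : Type u} [MulAction G Ω] (ω : Ω)

/-- The `S`-equivariant map `M → (Ω →₀ M)`, `m ↦ m ω`, for an `S`-fixed point `ω`. -/
def atPoint (hS : ∀ g ∈ S, g • ω = ω) (M : Rep.{u} k G) :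
    Rep.res S.subtype M ⟶ Rep.res S.subtype (perm Ω M) :=
  Rep.ofHom
    { toLinearMap := Finsupp.lsingle ω
      isIntertwining' g := by
        ext m : 1
        change Finsupp.single ω (M.ρ g m) = permRho Ω M g (Finsupp.single ω m)
        rw [permRho_single, hS _ g.2] }

/-- The chain map of Shapiro's lemma. -/
abbrev shapiroMap (hS : ∀ g ∈ S, g • ω = ω) (M : Rep.{u} k G) :
    groupHomology.inhomogeneousChains (Rep.res S.subtype M) ⟶
      groupHomology.inhomogeneousChains (perm Ω M) :=
  groupHomology.chainsMap S.subtype (atPoint ω hS M)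

theorem shapiroMap_naturality (hS : ∀ g ∈ S, g • ω = ω) {M M' : Rep.{u} k G} (f : M ⟶ M') :
    groupHomology.chainsMap (MonoidHom.id S) (Rep.resMap S.subtype f) ≫ shapiroMap ω hS M' =
      shapiroMap ω hS M ≫ groupHomology.chainsMap (MonoidHom.id G) (permCoeff Ω f) := by
  rw [← groupHomology.chainsMap_comp, ← groupHomology.chainsMap_comp]
  refine groupHomology.chainsMap_congr rfl ?_
  ext m : 1
  exact (permCoeff_single f ω m).symm

/-- `Res_S (G →₀ M)` has vanishing homology in positive degrees. -/
theorem isZero_groupHomology_res_perm (M : Rep.{u} k G) (n : ℕ) :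
    Limits.IsZero (groupHomology (Rep.res S.subtype (perm G M)) (n + 1)) := by
  -- `r g` represents the coset Sg, so `t g` is the S-component of g and t is S-equivariant. Placing
  -- the summand at g over the index `t g` therefore splits the augmentation.
  let r : G → G := fun g => (Quotient.mk (QuotientGroup.rightRel S) g).out
  have hr : ∀ g, g * (r g)⁻¹ ∈ S := fun g => by
    have : (QuotientGroup.rightRel S) (r g) g :=
      Quotient.exact (Quotient.out_eq _)
    rwa [QuotientGroup.rightRel_apply] at this
  let t : G → S := fun g => ⟨g * (r g)⁻¹, hr g⟩
  have hrs : ∀ (s : S) g, r (s * g) = r g := fun s g => by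
    have : (Quotient.mk (QuotientGroup.rightRel S) (s * g)) = Quotient.mk _ g := by
      refine Quotient.sound ?_
      change QuotientGroup.rightRel S _ _
      rw [QuotientGroup.rightRel_apply]
      simp
    simp only [r, this]
  have ht : ∀ (s : S) g, t (s * g) = s * t g := fun s g => by
    ext; simp [t, hrs, mul_assoc]
  refine isZero_groupHomology_succ (V := Rep.res S.subtype (perm G M)) (Rep.ofHom
    (σ := permRho S (Rep.res S.subtype (perm G M)))
    { toLinearMap := Finsupp.lsum k fun g =>
        Finsupp.lsingle (M := Rep.res S.subtype (perm G M)) (t g) ∘ₗ Finsupp.lsingle g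
      isIntertwining' s := ?_ }) ?_ n
  · refine Finsupp.lhom_ext fun g m => ?_
    change Finsupp.lsum k _ (permRho G M s (Finsupp.single g m)) = permRho S _ s _
    rw [permRho_single]
    simp only [Finsupp.lsum_single, LinearMap.comp_apply, Finsupp.lsingle_apply]
    rw [permRho_single]
    change _ = Finsupp.single (s * t g) (permRho G M s (Finsupp.single g m))
    rw [permRho_single, ← ht]
    rfl
  · ext1
    refine Representation.IntertwiningMap.ext (Finsupp.lhom_ext fun g m => ?_)
    change (permSum S _).hom (Finsupp.lsum k _ (Finsupp.single g m)) = _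
    rw [Finsupp.lsum_single]
    exact permSum_single _ _

/-- `Ω →₀ (G →₀ M)` has vanishing homology in positive degrees. -/
theorem isZero_groupHomology_perm_perm (M : Rep.{u} k G) (n : ℕ) :
    Limits.IsZero (groupHomology (perm Ω (perm G M)) (n + 1)) := by
  -- The splitting uses the inner G-coordinate: the element at (x, g) is placed over the index g.
  refine isZero_groupHomology_succ (permLift (V := perm G (perm Ω (perm G M)))
    (fun x => Finsupp.lsum k fun g => Finsupp.lsingle g ∘ₗ Finsupp.lsingle x ∘ₗ Finsupp.lsingle g)
    fun g x m => ?_) ?_ n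
  · change Finsupp.lsum k _ (permRho G M g m) = permRho G _ g (Finsupp.lsum k _ m)
    induction m using Finsupp.induction_linear with
    | zero => simp
    | add x y hx hy => simp only [map_add, hx, hy]
    | single h m =>
      rw [permRho_single]
      simp only [Finsupp.lsum_single, LinearMap.comp_apply, Finsupp.lsingle_apply]
      rw [permRho_single]
      change _ = Finsupp.single (g • h) (permRho Ω (perm G M) g (Finsupp.single x
        (Finsupp.single h m)))
      rw [permRho_single]
      change _ = Finsupp.single (g • h) (Finsupp.single (g • x)
        (permRho G M g (Finsupp.single h m)))
      rw [permRho_single]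
  · ext1
    refine Representation.IntertwiningMap.ext (Finsupp.lhom_ext fun x m => ?_)
    refine (congrArg (permSum G (perm Ω (perm G M))).hom (permLift_single _ _ x m)).trans ?_
    change _ = (Finsupp.single x m : Ω →₀ (G →₀ M))
    induction m using Finsupp.induction_linear with
    | zero => simp
    | add y z hy hz =>
      rw [map_add, map_add, hy, hz, ← Finsupp.single_add]
    | single h m =>
      rw [Finsupp.lsum_single]
      exact permSum_single _ _

variable [MulAction.IsPretransitive G Ω]

/-- With s(x)ω = x, sending m at x to the class of s(x)⁻¹m is a well defined left inverse on
coinvariants, because s(gx)⁻¹ g s(x) fixes ω. Surjectivity holds since m at x is the s(x)-translate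
of s(x)⁻¹m at ω. -/
theorem isIso_shapiroMap_zero (hS : ∀ g, g ∈ S ↔ g • ω = ω) (M : Rep.{u} k G) :
    IsIso (HomologicalComplex.homologyMap (shapiroMap ω (fun g => (hS g).1) M) 0) := by
  have hπ : ∀ m : M, HomologicalComplex.homologyMap (shapiroMap ω (fun g => (hS g).1) M) 0
      (groupHomology.H0π (Rep.res S.subtype M) m) =
      groupHomology.H0π (perm Ω M) (Finsupp.single ω m) := fun m =>
    congr($(groupHomology.H0π_comp_map S.subtype (atPoint ω (fun g => (hS g).1) M)) m)
  choose s hs using fun x : Ω => MulAction.exists_smul_eq G ω x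
  refine (ConcreteCategory.isIso_iff_bijective _).2 ⟨?_, ?_⟩
  · refine (injective_iff_map_eq_zero _).2 fun x => ?_
    refine groupHomology.H0_induction_on _ x fun m hm => ?_
    rw [hπ] at hm
    replace hm := (H0π_eq_zero_iff (perm Ω M) _).1 hm
    refine (H0π_eq_zero_iff _ _).2 ?_
    let r : (Ω →₀ M) →ₗ[k] Representation.Coinvariants (Rep.res S.subtype M).ρ :=
      Finsupp.lsum k fun x => Representation.Coinvariants.mk (Rep.res S.subtype M).ρ ∘ₗ
        M.ρ (s x)⁻¹
    have hr : ∀ g, r ∘ₗ permRho Ω M g = r := fun g => by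
      refine Finsupp.lhom_ext fun x m => ?_
      have hg : (s (g • x))⁻¹ * g * s x ∈ S := by
        rw [hS, mul_smul, hs, mul_smul, inv_smul_eq_iff, hs]
      have := Representation.Coinvariants.mk_self_apply (Rep.res S.subtype M).ρ
        ⟨_, hg⟩ (M.ρ (s x)⁻¹ m)
      rw [LinearMap.comp_apply, permRho_single]
      simp only [r, Finsupp.lsum_single, LinearMap.comp_apply]
      rw [← this]
      congr 1
      change _ = M.ρ ((s (g • x))⁻¹ * g * s x) _
      simp [← Module.End.mul_apply, ← map_mul, mul_assoc]
    have h0 := congrArg (Representation.Coinvariants.lift (permRho Ω M) r hr) hm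
    rw [map_zero, Representation.Coinvariants.lift_mk] at h0
    have hω : (s ω)⁻¹ ∈ S := by rw [hS, inv_smul_eq_iff, hs]
    rw [← Representation.Coinvariants.mk_self_apply (Rep.res S.subtype M).ρ ⟨_, hω⟩ m]
    simpa [r] using h0
  · intro y
    refine groupHomology.H0_induction_on _ y fun v => ?_
    change ∃ x, _ = groupHomology.H0π (perm Ω M) v
    induction v using Finsupp.induction_linear with
    | zero => exact ⟨0, by rw [map_zero, map_zero]; rfl⟩
    | add v w hv hw =>
      obtain ⟨a, ha⟩ := hv
      obtain ⟨b, hb⟩ := hw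
      exact ⟨a + b, by rw [map_add, ha, hb, map_add]; rfl⟩
    | single x m =>
      refine ⟨groupHomology.H0π (Rep.res S.subtype M) (M.ρ (s x)⁻¹ m), ?_⟩
      rw [hπ, ← sub_eq_zero, ← map_sub, H0π_eq_zero_iff, map_sub, sub_eq_zero,
        ← Representation.Coinvariants.mk_self_apply (permRho Ω M) (s x), permRho_single, hs]
      simp

section Step

variable (M : Rep.{u} k G)

/-- The dimension shifting sequence `0 → M' → (G →₀ M) → M → 0`. -/
abbrev shiftSeq : ShortComplex (Rep.{u} k G) :=
  ShortComplex.mk (kerι (permSum G M)) (permSum G M) (by ext x; exact x.2)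

theorem shiftSeq_res_shortExact : ((shiftSeq M).map (Rep.resFunctor S.subtype)).ShortExact :=
  (Rep.shortExact_res S.subtype).2 (shortExact_ker _ permSum_surjective)

omit [MulAction.IsPretransitive G Ω] in
variable (Ω) in
theorem shiftSeq_perm_exact :
    permCoeff Ω (kerι (permSum G M)) ≫ permCoeff Ω (permSum G M) = 0 := by
  rw [← permCoeff_comp, (shiftSeq M).zero, permCoeff_zero]

omit [MulAction.IsPretransitive G Ω] in
variable (Ω) in
theorem shiftSeq_perm_shortExact :
    (ShortComplex.mk _ _ (shiftSeq_perm_exact Ω M)).ShortExact :=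
  shortExact_permCoeff (Ω := Ω) (kerι (permSum G M)) (permSum G M) Subtype.val_injective
    permSum_surjective (exact_kerι _)

omit [MulAction.IsPretransitive G Ω] in
/-- The Shapiro maps for the dimension shifting sequence. -/
def shapiroShift (hS : ∀ g ∈ S, g • ω = ω) :
    ((shiftSeq M).map (Rep.resFunctor S.subtype)).map (groupHomology.chainsFunctor k S) ⟶
      (ShortComplex.mk (permCoeff Ω (kerι (permSum G M))) (permCoeff Ω (permSum G M))
        (shiftSeq_perm_exact Ω M)).map (groupHomology.chainsFunctor k G) where
  τ₁ := shapiroMap ω hS _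
  τ₂ := shapiroMap ω hS _
  τ₃ := shapiroMap ω hS _
  comm₁₂ := (shapiroMap_naturality ω hS _).symm
  comm₂₃ := (shapiroMap_naturality ω hS _).symm

end Step

/-- Dimension shifting along 0 → M' → (G →₀ M) → M → 0, whose middle term has no positive-degree
homology on either side, and the five lemma. -/
theorem isIso_shapiroMap (hS : ∀ g, g ∈ S ↔ g • ω = ω) (M : Rep.{u} k G) (n : ℕ) :
    IsIso (HomologicalComplex.homologyMap (shapiroMap ω (fun g => (hS g).1) M) n) := by
  induction n generalizing M with
  | zero => exact isIso_shapiroMap_zero ω hS M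
  | succ n ih =>
    have h₁ M := groupHomology.map_chainsFunctor_shortExact
      (shiftSeq_res_shortExact (S := S) (k := k) M)
    have h₂ M := groupHomology.map_chainsFunctor_shortExact
      (shiftSeq_perm_shortExact (k := k) (G := G) Ω M)
    have hF : ∀ M : Rep.{u} k G, IsIso (HomologicalComplex.homologyMap
        (shapiroShift ω M (fun g => (hS g).1)).τ₂ (n + 1)) := fun M =>
      (isZero_groupHomology_res_perm M n).isIso (isZero_groupHomology_perm_perm M n) _
    have hrel : ∀ j, (ComplexShape.down ℕ).Rel (n + 1) j → j = n := fun j h => by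
      simpa using h
    -- Surjectivity in degree n + 1 is obtained for every module first: bijectivity for M uses
    -- surjectivity for the kernel M' in that same degree.
    have hepi : ∀ M : Rep.{u} k G, Epi (HomologicalComplex.homologyMap
        (shapiroMap ω (fun g => (hS g).1) M) (n + 1)) := fun M => by
      refine HomologicalComplex.HomologySequence.epi_homologyMap_τ₃
        (shapiroShift ω M (fun g => (hS g).1)) (h₁ M) (h₂ M) (n + 1) ?_ ?_ ?_
      · have := hF M
        infer_instance
      · intro j hj
        obtain rfl := hrel j hj
        have := ih (ker (permSum G M))
        exact IsIso.epi_of_iso (HomologicalComplex.homologyMap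
          (shapiroMap ω (fun g => (hS g).1) (ker (permSum G M))) j)
      · intro j hj
        obtain rfl := hrel j hj
        have := ih (perm G M)
        exact IsIso.mono_of_iso (HomologicalComplex.homologyMap
          (shapiroMap ω (fun g => (hS g).1) (perm G M)) j)
    refine HomologicalComplex.HomologySequence.isIso_homologyMap_τ₃
      (shapiroShift ω M (fun g => (hS g).1)) (h₁ M) (h₂ M) (n + 1) ?_ (hF M) ?_ ?_
    · exact hepi _
    · intro j hj
      obtain rfl := hrel j hj
      exact ih (ker (permSum G M))
    · intro j hj
      obtain rfl := hrel j hj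
      have := ih (perm G M)
      exact IsIso.mono_of_iso (HomologicalComplex.homologyMap
        (shapiroMap ω (fun g => (hS g).1) (perm G M)) j)

end Shapiro

end PermRep

/-! ### Relative homology and coinvariants through long exact sequences -/

namespace PermRep

section Cokernel

variable {C : Type*} [Category* C] [Abelian C]

/-- This is the middle of the six-term kernel-cokernel sequence of f and g; its neighbours ker (f ≫
g) and coker g vanish. -/
theorem shortExact_kernel_cokernel {X Y Z : C} (f : X ⟶ Y) (g : Y ⟶ Z) [Mono (f ≫ g)] [Epi g] :
    (ShortComplex.mk (kernelCokernelCompSequence.δ f g)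
      (Limits.cokernel.map f (f ≫ g) (𝟙 _) g (by simp))
      ((kernelCokernelCompSequence_exact f g).toIsComplex.zero 2)).ShortExact where
  exact := (kernelCokernelCompSequence_exact f g).exact 2
  mono_f := ((kernelCokernelCompSequence_exact f g).exact 1).mono_g
      ((Limits.isZero_kernel_of_mono (f ≫ g)).eq_of_src _ _)
  epi_g := epi_of_epi_fac (f := Limits.cokernel.π f) (h := g ≫ Limits.cokernel.π (f ≫ g)) (by simp)

/-- If `a : W ⟶ X₂` is a quasi-isomorphism and `0 ⟶ X₁ ⟶ X₂ ⟶ X₃ ⟶ 0` is exact, then the homology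
of the cokernel of `W ⟶ X₃` is the shifted homology of `X₁`. -/
theorem homology_cokernel_comp {S : ShortComplex (ChainComplex C ℕ)} (hS : S.ShortExact)
    {W : ChainComplex C ℕ} (a : W ⟶ S.X₂) (c : W ⟶ S.X₃) (hc : a ≫ S.g = c) (hm : Mono c)
    (ha : ∀ n, IsIso (HomologicalComplex.homologyMap a n)) (n : ℕ) :
    Nonempty ((Limits.cokernel c).homology (n + 1) ≅ S.X₁.homology n) := by
  subst hc
  have := hS.epi_g
  have := hS.mono_f
  have : Mono a := mono_of_mono a S.g
  have hses := shortExact_kernel_cokernel a S.g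
  have hcok : (ShortComplex.mk a (Limits.cokernel.π a) (by simp)).ShortExact :=
    { exact := ShortComplex.exact_cokernel a
      mono_f := inferInstance
      epi_g := inferInstance }
  -- The cokernel of a is acyclic because a is an injective quasi-isomorphism. In 0 → ker g → coker
  -- a → coker (a ≫ g) → 0 the connecting map is then an isomorphism.
  have hz : ∀ n, Limits.IsZero ((Limits.cokernel a).homology n) := fun n => by
    refine (HomologicalComplex.exactAt_iff_isZero_homology _ _).1 (hcok.exactAt_X₃ n ?_ ?_)
    · have := ha n; exact IsIso.epi_of_iso (HomologicalComplex.homologyMap a n)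
    · intro j _; have := ha j; exact IsIso.mono_of_iso (HomologicalComplex.homologyMap a j)
  have hrel : (ComplexShape.down ℕ).Rel (n + 1) n := by simp
  have hiso : IsIso (hses.δ (n + 1) n hrel) := hses.isIso_δ _ _ _ (hz _) (hz _)
  let e : Limits.kernel S.g ≅ S.X₁ :=
    (Limits.kernelIsKernel S.g).conePointUniqueUpToIso hS.fIsKernel
  exact ⟨asIso (hses.δ (n + 1) n hrel) ≪≫
    (HomologicalComplex.homologyFunctor C _ n).mapIso e⟩

end Cokernel

section Relative

open RefinedScissors

variable {G : Type u} [Group G] {K : Subgroup G} {Ω : Type u} [MulAction G Ω] (ω : Ω)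

/-- The Shapiro map with integral coefficients. -/
def shapiroZ (hK : ∀ g ∈ K, g • ω = ω) : groupHomology.inhomogeneousChains (trivZ K) ⟶
    groupHomology.inhomogeneousChains (perm Ω (trivZ G)) :=
  shapiroMap ω hK (trivZ G)

/-- Both composites are the chain map induced by K ⊆ G and m ↦ f(mω). With L = G this identifies the
augmentation of ℤ[Ω] with the map from the chains of K to those of G; with L a larger stabilizer it
identifies ℤ[Ω] → ℤ[Ω'] with the map of stabilizers. -/
theorem shapiroZ_comp (hK : ∀ g ∈ K, g • ω = ω) {M : Rep.{u} (ULift.{u} ℤ) G}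
    (f : perm Ω (trivZ G) ⟶ M) {L : Type u} [Group L] (p : K →* L) (q : L →* G)
    (hpq : q.comp p = K.subtype) (r : trivZ L ⟶ Rep.res q M)
    (hr : ∀ m : ULift.{u} ℤ, r.hom m = f.hom (Finsupp.single ω m)) :
    shapiroZ ω hK ≫ groupHomology.chainsMap (B := M) (MonoidHom.id G) f =
      chainsMapZ p ≫ groupHomology.chainsMap (A := trivZ L) q r := by
  refine Eq.trans (groupHomology.chainsMap_comp K.subtype (MonoidHom.id G)
    (atPoint ω hK (trivZ G)) f).symm ?_
  refine Eq.trans ?_ (groupHomology.chainsMap_comp (A := trivZ K) (B := trivZ L)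
    (C := M) p q (𝟙 (trivZ K)) r)
  refine groupHomology.chainsMap_congr (A := trivZ K) hpq.symm ?_
  refine DFunLike.coe_injective (funext fun m => ?_)
  exact (hr m).symm

variable [MulAction.IsPretransitive G Ω]

theorem bijective_shapiroZ (hK : ∀ g, g ∈ K ↔ g • ω = ω) (n : ℕ) :
    Function.Bijective (HomologicalComplex.homologyMap (shapiroZ ω (fun g => (hK g).1)) n) :=
  (ConcreteCategory.isIso_iff_bijective _).1 (isIso_shapiroMap ω hK (trivZ G) n)

theorem mono_chainsMapZ_subtype : Mono (chainsMapZ K.subtype) := by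
  have h1 : Mono (show trivZ K ⟶ Rep.res K.subtype (trivZ G) from 𝟙 (trivZ K)) :=
    inferInstanceAs (Mono (𝟙 (trivZ K)))
  exact HomologicalComplex.mono_of_mono_f _ fun i =>
    groupHomology.chainsMap_f_map_mono (A := trivZ K) (B := trivZ G) K.subtype
      (𝟙 (trivZ K)) K.subtype_injective i

/-- If `K` is the stabilizer of a point of a transitive `G`-set `Ω`, then `H_{n+1}(G, K)` is the
homology of the kernel of the augmentation of `ℤ[Ω]`. -/
theorem relHomology_iso (hK : ∀ g, g ∈ K ↔ g • ω = ω) (n : ℕ) :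
    Nonempty (relHomology K (n + 1) ≅ groupHomology (ker (permSum Ω (trivZ G))) n) := by
  have : Nonempty Ω := ⟨ω⟩
  have hS := groupHomology.map_chainsFunctor_shortExact
    (shortExact_ker (permSum Ω (trivZ G)) permSum_surjective)
  refine homology_cokernel_comp hS (shapiroZ ω (fun g => (hK g).1)) (chainsMapZ K.subtype) ?_
    mono_chainsMapZ_subtype
    (fun n => (ConcreteCategory.isIso_iff_bijective _).2 (bijective_shapiroZ ω hK n)) n
  refine (shapiroZ_comp ω (fun g => (hK g).1) (permSum Ω (trivZ G)) K.subtype (MonoidHom.id G) rfl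
    (𝟙 (trivZ G)) fun m => (permSum_single (M := trivZ G) ω m).symm).trans ?_
  rw [groupHomology.chainsMap_id, Category.comp_id]

/-- If stabilizers `S ≤ S'` of points `ω ↦ f ω` have the same homology, then the homology of the
kernel of `ℤ[Ω] → ℤ[Ω']` vanishes. -/
theorem isZero_groupHomology_ker_permMap {Ω' : Type u} [MulAction G Ω']
    [MulAction.IsPretransitive G Ω'] (f : Ω → Ω') (hf : ∀ (g : G) x, f (g • x) = g • f x)
    (hfs : Function.Surjective f) {S S' : Subgroup G} (hle : S ≤ S')
    (hS : ∀ g, g ∈ S ↔ g • ω = ω) (hS' : ∀ g, g ∈ S' ↔ g • f ω = f ω) (n : ℕ)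
    (hn : Function.Injective (homologyMapZ (Subgroup.inclusion hle) n))
    (hn' : Function.Surjective (homologyMapZ (Subgroup.inclusion hle) (n + 1))) :
    Limits.IsZero (groupHomology (ker (permMap (trivZ G) f hf)) n) := by
  have hses := groupHomology.map_chainsFunctor_shortExact
    (shortExact_ker (permMap (trivZ G) f hf) (permMap_surjective f hf hfs))
  have e := shapiroZ_comp ω (fun g => (hS g).1) (permMap (trivZ G) f hf) (Subgroup.inclusion hle)
    S'.subtype rfl (atPoint (f ω) (fun g => (hS' g).1) (trivZ G))
    fun m => (permMap_single (M := trivZ G) f hf ω m).symm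
  have e' : ∀ i x, HomologicalComplex.homologyMap (groupHomology.chainsMap
      (B := perm Ω' (trivZ G)) (MonoidHom.id G) (permMap (trivZ G) f hf)) i
      (HomologicalComplex.homologyMap (shapiroZ ω (fun g => (hS g).1)) i x) =
      HomologicalComplex.homologyMap (shapiroZ (f ω) (fun g => (hS' g).1)) i
        (homologyMapZ (Subgroup.inclusion hle) i x) := by
    intro i x
    have h := congrArg (fun t => HomologicalComplex.homologyMap t i) e
    change HomologicalComplex.homologyMap (_ ≫ _) i = HomologicalComplex.homologyMap
      (_ ≫ shapiroZ (f ω) (fun g => (hS' g).1)) i at h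
    rw [HomologicalComplex.homologyMap_comp, HomologicalComplex.homologyMap_comp] at h
    exact congr($h x)
  -- In the long exact sequence, H_n of the kernel sits between the cokernel in degree n + 1 and the
  -- kernel in degree n of H(G, ℤ[Ω]) → H(G, ℤ[Ω']). Shapiro's lemma turns both conditions into ones
  -- on S ≤ S'.
  refine (HomologicalComplex.exactAt_iff_isZero_homology _ _).1 (hses.exactAt_X₁ n ?_ ?_)
  · refine (ModuleCat.mono_iff_injective _).2 (Function.Injective.of_comp_right
      (g := HomologicalComplex.homologyMap (shapiroZ ω (fun g => (hS g).1)) n) ?_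
      (bijective_shapiroZ ω hS n).2)
    intro x y hxy
    refine hn ((bijective_shapiroZ (f ω) hS' n).1 ?_)
    rw [← e', ← e']
    exact hxy
  · intro i hi
    obtain rfl : n + 1 = i := by simpa using hi
    refine (ModuleCat.epi_iff_surjective _).2 (Function.Surjective.of_comp
      (g := HomologicalComplex.homologyMap (shapiroZ ω (fun g => (hS g).1)) (n + 1)) ?_)
    intro y
    obtain ⟨x, rfl⟩ := ((bijective_shapiroZ (f ω) hS' (n + 1)).2.comp hn') y
    exact ⟨x, e' _ x⟩

end Relative

section Boundary

variable {k G : Type u} [CommRing k] [Group G]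

/-- The coinvariants of a representation, as an additive group. -/
def coinv (M : Rep.{u} k G) : Type u := M.ρ.Coinvariants

instance (M : Rep.{u} k G) : AddCommGroup (coinv M) :=
  inferInstanceAs (AddCommGroup M.ρ.Coinvariants)

/-- The projection onto the coinvariants. -/
def coinvMk (M : Rep.{u} k G) : M →+ coinv M := (Representation.Coinvariants.mk M.ρ).toAddMonoidHom

theorem coinvMk_surjective (M : Rep.{u} k G) : Function.Surjective (coinvMk M) :=
  Representation.Coinvariants.mk_surjective M.ρ

theorem coinvMk_rho (M : Rep.{u} k G) (g : G) (x : M) : coinvMk M (M.ρ g x) = coinvMk M x :=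
  Representation.Coinvariants.mk_self_apply M.ρ g x

/-- An additive map which is invariant kills the kernel of the projection to the coinvariants. -/
theorem eq_zero_of_coinvMk_eq_zero {M : Rep.{u} k G} {W : Type*} [AddCommGroup W] (f : M →+ W)
    (hf : ∀ (g : G) x, f (M.ρ g x) = f x) {x : M} (hx : coinvMk M x = 0) : f x = 0 := by
  have hx' : x ∈ Representation.Coinvariants.ker M.ρ :=
    (Representation.Coinvariants.mk_eq_zero (ρ := M.ρ)).1 hx
  -- The kernel of the projection is a k-span while f is only additive, so the induction has to
  -- carry all scalar multiples.
  suffices h : ∀ c : k, f (c • x) = 0 by simpa using h 1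
  clear hx
  induction hx' using Submodule.span_induction with
  | mem x hx =>
    obtain ⟨⟨g, y⟩, rfl⟩ := hx
    intro c
    rw [smul_sub, ← map_smul, map_sub, hf, sub_self]
  | zero => simp
  | add x y _ _ hx hy => exact fun c => by rw [smul_add, map_add, hx, hy, add_zero]
  | smul a x _ hx => exact fun c => by rw [smul_smul, hx]

/-- Functoriality of coinvariants. -/
def coinvMap {M N : Rep.{u} k G} (f : M ⟶ N) : coinv M →+ coinv N :=
  (Representation.Coinvariants.map M.ρ N.ρ f.hom).toAddMonoidHom

/-- Let `P` be the kernel of an epimorphism `τ : X ⟶ Q`. If `H_1(G, X) = 0`, then `H_1(G, Q)` is the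
kernel of `P_G → X_G`. -/
theorem H1_equiv_ker {X Q : Rep.{u} k G} (τ : X ⟶ Q) (hτ : Function.Surjective τ.hom)
    (hX : Limits.IsZero (groupHomology X 1)) :
    Nonempty (groupHomology Q 1 ≃+ (coinvMap (kerι τ)).ker) := by
  have hses := shortExact_ker τ hτ
  have hmono := groupHomology.mono_δ_of_isZero hses 0 hX
  let e := groupHomology.H0Iso (ker τ)
  let d : groupHomology Q 1 →ₗ[k] Representation.Coinvariants (ker τ).ρ :=
    (groupHomology.δ hses 1 0 rfl ≫ e.hom).hom
  have hd : Function.Injective d := by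
    have : Mono (groupHomology.δ hses 1 0 rfl ≫ e.hom) := mono_comp _ _
    exact (ModuleCat.mono_iff_injective _).1 this
  have hr : LinearMap.range d = LinearMap.ker
      (Representation.Coinvariants.map (ker τ).ρ X.ρ (kerι τ).hom) := by
    have hnat := groupHomology.map_id_comp_H0Iso_hom (kerι τ)
    have hex := (groupHomology.mapShortComplex₁_exact hses (zero_add 1))
    rw [ShortComplex.moduleCat_exact_iff_range_eq_ker] at hex
    have he : Function.Injective (groupHomology.H0Iso X).hom :=
      (ModuleCat.mono_iff_injective _).1 inferInstance
    ext y
    obtain ⟨z, rfl⟩ : ∃ z, e.hom z = y := ⟨e.inv y, by simp⟩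
    have hz : (groupHomology.H0Iso X).hom (groupHomology.map (MonoidHom.id G) (kerι τ) 0 z) =
      Representation.Coinvariants.map (ker τ).ρ X.ρ (kerι τ).hom (e.hom z) := congr($hnat z)
    rw [LinearMap.mem_ker, ← hz, map_eq_zero_iff _ he]
    refine Iff.trans ?_ (SetLike.ext_iff.1 hex z)
    constructor
    · rintro ⟨x, hx⟩
      exact ⟨x, (ModuleCat.mono_iff_injective e.hom).1 inferInstance hx⟩
    · rintro ⟨x, rfl⟩
      exact ⟨x, rfl⟩
  exact ⟨((LinearEquiv.ofInjective d hd).trans (LinearEquiv.ofEq _ _ hr)).toAddEquiv⟩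

end Boundary

end PermRep

/-! ### Free G-sets and the chain of dimension shifts -/

namespace PermRep

section Free

variable {k G : Type u} [CommRing k] [Group G] {Ω : Type u} [MulAction G Ω]

/-- Permutation representations of free `G`-sets have vanishing homology in positive degrees. -/
theorem isZero_groupHomology_perm_of_free (M : Rep.{u} k G)
    (hfree : ∀ (g : G) (x : Ω), g • x = x → g = 1) (n : ℕ) :
    Limits.IsZero (groupHomology (perm Ω M) (n + 1)) := by
  -- Choose orbit representatives o. By freeness the element t x with t x • o x = x is unique, so t
  -- : Ω → G is equivariant and splits the augmentation as before.
  let o : Ω → Ω := fun x => (Quotient.mk (MulAction.orbitRel G Ω) x).out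
  have ho : ∀ (g : G) x, o (g • x) = o x := fun g x => by
    have : Quotient.mk (MulAction.orbitRel G Ω) (g • x) = Quotient.mk _ x :=
      Quotient.sound ⟨g, rfl⟩
    simp only [o, this]
  have ht : ∀ x, ∃ g : G, g • o x = x := fun x => by
    have : (MulAction.orbitRel G Ω) x (o x) := (MulAction.orbitRel G Ω).symm
      (Quotient.exact (Quotient.out_eq _))
    exact this
  choose t ht using ht
  have htg : ∀ (g : G) x, t (g • x) = g * t x := fun g x => by
    have h := ht (g • x)
    rw [ho] at h
    have := hfree ((g * t x)⁻¹ * t (g • x)) (o x) (by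
      rw [mul_smul, h, inv_smul_eq_iff, mul_smul, ht])
    exact (inv_mul_eq_one.1 this).symm
  refine isZero_groupHomology_succ (permLift (V := perm G (perm Ω M))
    (fun x => Finsupp.lsingle (t x) ∘ₗ Finsupp.lsingle x) fun g x m => ?_) ?_ n
  · simp only [LinearMap.comp_apply, Finsupp.lsingle_apply]
    rw [permRho_single]
    change _ = Finsupp.single (g • t x) (permRho Ω M g (Finsupp.single x m))
    rw [permRho_single, htg]
    rfl
  · ext1
    refine Representation.IntertwiningMap.ext (Finsupp.lhom_ext fun x m => ?_)
    refine (congrArg (permSum G (perm Ω M)).hom (permLift_single _ _ x m)).trans ?_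
    exact permSum_single (M := perm Ω M) (t x) _

end Free

section Chain

open RefinedScissors

variable {G : Type u} [Group G] {Ω₁ Ω₀ Ω' : Type u} [MulAction G Ω₁] [MulAction G Ω₀]
  [MulAction G Ω'] (q : Ω₁ → Ω') (hq : ∀ (g : G) x, q (g • x) = g • q x)
  (s : Ω₁ → Ω₀) (hs : ∀ (g : G) x, s (g • x) = g • s x)

/-- The map from the kernel of `ℤ[Ω₁] → ℤ[Ω₀]` to the augmentation kernel of `ℤ[Ω']`. -/
def kerToAugKer : ker (permMap (trivZ G) s hs) ⟶ ker (permSum Ω' (trivZ G)) :=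
  kerLift _ (kerι (permMap (trivZ G) s hs) ≫ permMap (trivZ G) q hq) fun x => by
    refine (permSum_mapDomain (M := trivZ G) q x.1).trans ?_
    rw [← permSum_mapDomain (M := trivZ G) s x.1]
    have hx : Finsupp.mapDomain s x.1 = 0 := x.2
    rw [hx, map_zero]

variable [MulAction.IsPretransitive G Ω₁] [MulAction.IsPretransitive G Ω₀]
  [MulAction.IsPretransitive G Ω']

/-- Relative homology `H_3(G, K)` in terms of permutation modules on `G`-sets with stabilizers
`T ≤ K` and `T ≤ B`, where `T` and `B` have the same homology in low degrees. -/
theorem relHomology_equiv_ker (ω : Ω₁) (hss : Function.Surjective s) {T K B : Subgroup G}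
    (hT : ∀ g, g ∈ T ↔ g • ω = ω) (hK : ∀ g, g ∈ K ↔ g • q ω = q ω)
    (hB : ∀ g, g ∈ B ↔ g • s ω = s ω) (hle : T ≤ B)
    (h1 : Function.Injective (homologyMapZ (Subgroup.inclusion hle) 1))
    (h2 : Function.Bijective (homologyMapZ (Subgroup.inclusion hle) 2))
    (h3 : Function.Bijective (homologyMapZ (Subgroup.inclusion hle) 3))
    (hsurj : Function.Surjective (kerToAugKer q hq s hs).hom)
    {X : Rep.{u} (ULift.{u} ℤ) G} (τ : X ⟶ ker (kerToAugKer q hq s hs))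
    (hτ : Function.Surjective τ.hom) (hX : Limits.IsZero (groupHomology X 1)) :
    Nonempty (relHomology K 3 ≃+ (coinvMap (kerι τ)).ker) := by
  obtain ⟨e₁⟩ := relHomology_iso (q ω) hK 2
  obtain ⟨e₂⟩ := H1_equiv_ker τ hτ hX
  -- The kernel of ℤ[Ω₁] → ℤ[Ω₀] has no homology in degrees 1 and 2, so the connecting map carries
  -- H_2 of the augmentation kernel isomorphically to H_1 of the kernel of `kerToAugKer`.
  have hN₁ := isZero_groupHomology_ker_permMap ω s hs hss hle hT hB 1 h1 h2.2
  have hN₂ := isZero_groupHomology_ker_permMap ω s hs hss hle hT hB 2 h2.1 h3.2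
  have := groupHomology.isIso_δ_of_isZero (shortExact_ker _ hsurj) 1 hN₂ hN₁
  let e₃ := asIso (groupHomology.δ (shortExact_ker _ hsurj) 2 1 rfl)
  exact ⟨((e₁ ≪≫ e₃).toLinearEquiv.toAddEquiv).trans e₂⟩

end Chain

end PermRep

/-! ### The action of PSL_2(A) on lines, edges and triples -/

namespace RefinedScissors

section Action

variable (A : Type u) [CommRing A]

/-- A central element of `SL_2(A)` is scalar. -/
theorem exists_scalar_of_mem_center {g : SL(2, A)} (hg : g ∈ Subgroup.center SL(2, A)) :
    ∃ r : A, r ^ 2 = 1 ∧ g 0 0 = r ∧ g 1 1 = r ∧ g 0 1 = 0 ∧ g 1 0 = 0 := by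
  obtain ⟨r, hr, h⟩ := Matrix.SpecialLinearGroup.mem_center_iff.1 hg
  have h' : ∀ i j, g i j = Matrix.scalar (Fin 2) r i j := fun i j => by rw [h]
  exact ⟨r, by simpa using hr, by simp [h'], by simp [h'], by simp [h'], by simp [h']⟩

theorem mem_center_of_scalar {g : SL(2, A)} (h : g 0 0 = g 1 1) (h01 : g 0 1 = 0)
    (h10 : g 1 0 = 0) : g ∈ Subgroup.center SL(2, A) := by
  have hdet := g.det_coe
  rw [Matrix.det_fin_two, h01, h10, h] at hdet
  refine Matrix.SpecialLinearGroup.mem_center_iff.2 ⟨g 1 1, by simpa [sq] using hdet, ?_⟩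
  ext i j
  fin_cases i <;> fin_cases j <;> simp [h, h01, h10]

variable {A}

/-- The action of `SL_2(A)` on simplices, by permutations. -/
def slPerm (n : ℕ) : SL(2, A) →* Equiv.Perm (Simplex A n) :=
  (MulAction.toPermHom (GL (Fin 2) A) (Simplex A n)).comp Matrix.SpecialLinearGroup.toGL

theorem slPerm_center (n : ℕ) : Subgroup.center SL(2, A) ≤ (slPerm (A := A) n).ker := by
  intro g hg
  obtain ⟨r, hr, h00, h11, h01, h10⟩ := exists_scalar_of_mem_center A hg
  have e : Matrix.SpecialLinearGroup.toGL g =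
      Matrix.GeneralLinearGroup.scalar (Fin 2) (⟨r, r, by rw [← sq, hr], by rw [← sq, hr]⟩ : Aˣ) := by
    ext i j
    fin_cases i <;> fin_cases j <;> simp [h00, h11, h01, h10]
  refine Equiv.ext fun p => ?_
  change Matrix.SpecialLinearGroup.toGL g • p = p
  rw [e, scalar_smul]

/-- The action of `PSL_2(A)` on simplices. -/
instance pslAction (n : ℕ) : MulAction PSL(2, A) (Simplex A n) :=
  MulAction.compHom (Simplex A n)
    (QuotientGroup.lift (Subgroup.center SL(2, A)) (slPerm n) (slPerm_center n))

theorem line_smul {n : ℕ} (g : SL(2, A)) (p : Simplex A n) (i : Fin (n + 1)) :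
    ((QuotientGroup.mk g : PSL(2, A)) • p).line i = (p.line i).map g.1.mulVecLin := rfl

theorem face_psl {n : ℕ} (i : Fin (n + 2)) (g : PSL(2, A)) (p : Simplex A (n + 1)) :
    face i (g • p) = g • face i p := by
  obtain ⟨g, rfl⟩ := QuotientGroup.mk_surjective g
  rfl

theorem mk_mem_proj {H : Subgroup SL(2, A)} (hH : Subgroup.center SL(2, A) ≤ H) (g : SL(2, A)) :
    (QuotientGroup.mk g : PSL(2, A)) ∈ proj A H ↔ g ∈ H := by
  constructor
  · rintro ⟨h, hh, e⟩
    have := QuotientGroup.eq.1 (show (QuotientGroup.mk h : PSL(2, A)) = QuotientGroup.mk g from e)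
    simpa using H.mul_mem hh (hH this)
  · intro h
    exact ⟨g, h, rfl⟩

theorem center_le_T : Subgroup.center SL(2, A) ≤ T A := fun g hg => by
  obtain ⟨r, -, -, -, h01, h10⟩ := exists_scalar_of_mem_center A hg
  exact ⟨h01, h10⟩

theorem center_le_B : Subgroup.center SL(2, A) ≤ B A := fun _ hg => (center_le_T hg).2

theorem center_le_SM : Subgroup.center SL(2, A) ≤ SM A := fun _ hg => Or.inl (center_le_T hg)

end Action

section Simplices

variable {A : Type u} [CommRing A]

/-- The `1`-simplex spanned by two vectors. -/
def edgeOfVec (v w : Fin 2 → A) (hv : Unimodular v) (hw : Unimodular w)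
    (h : IsUnit (v 0 * w 1 - w 0 * v 1)) : Simplex A 1 where
  line := ![Submodule.span A {v}, Submodule.span A {w}]
  exists_vec := ⟨![v, w], by intro i; fin_cases i <;> assumption,
    by intro i; fin_cases i <;> rfl, by
      intro i j hij
      refine isBasisPair_of_isUnit ?_
      fin_cases i <;> fin_cases j
      · simp at hij
      · exact h
      · have := h.neg
        rw [neg_sub] at this
        exact this
      · simp at hij⟩

variable (A) in
/-- The edge `(∞, 0)`. -/
def edge : Simplex A 1 := edgeOfVec ![1, 0] ![0, 1] ⟨1, 0, by simp⟩ ⟨0, 1, by simp⟩ (by simp)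

theorem isUnit_of_isBasisPair {v w : Fin 2 → A} (h : IsBasisPair v w) :
    IsUnit (v 0 * w 1 - w 0 * v 1) := by
  rw [IsBasisPair, (Pi.basisFun A (Fin 2)).is_basis_iff_det, Module.Basis.det_apply,
    Matrix.det_fin_two] at h
  simpa [Module.Basis.toMatrix_apply] using h

/-- The interchange of the two lines of an edge. -/
def swap (p : Simplex A 1) : Simplex A 1 where
  line i := p.line (Fin.rev i)
  exists_vec := by
    obtain ⟨v, h1, h2, h3⟩ := p.exists_vec
    exact ⟨fun i => v (Fin.rev i), fun i => h1 _, fun i => h2 _, fun i j hij =>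
      h3 _ _ fun h => hij (Fin.rev_injective h)⟩

theorem swap_swap (p : Simplex A 1) : swap (swap p) = p := by
  ext i : 2
  exact congrArg p.line (Fin.rev_rev i)

theorem swap_smul (g : PSL(2, A)) (p : Simplex A 1) : swap (g • p) = g • swap p := by
  obtain ⟨g, rfl⟩ := QuotientGroup.mk_surjective g
  rfl

theorem face_one_swap (p : Simplex A 1) : face 1 (swap p) = face 0 p := by
  ext i : 2; fin_cases i; rfl

theorem map_span_mulVecLin (m : Matrix (Fin 2) (Fin 2) A) (v w : Fin 2 → A) (c : A) (hc : IsUnit c)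
    (h : m.mulVec v = c • w) :
    (Submodule.span A {v}).map m.mulVecLin = Submodule.span A {w} := by
  rw [Submodule.map_span, Set.image_singleton, Matrix.mulVecLin_apply, h]
  exact Submodule.span_singleton_smul_eq hc w

theorem exists_smul_edge (p : Simplex A 1) : ∃ g : SL(2, A),
    (QuotientGroup.mk g : PSL(2, A)) • edge A = p := by
  obtain ⟨v, h1, h2, h3⟩ := p.exists_vec
  obtain ⟨d, hd⟩ := isUnit_of_isBasisPair (h3 0 1 (by simp))
  have hd' : (d : A) * ↑d⁻¹ = 1 := d.mul_inv
  -- The columns are v₀ and d⁻¹v₁, where d is the determinant of (v₀, v₁): rescaling one column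
  -- makes the determinant 1 and preserves its line.
  obtain ⟨g, hg⟩ : ∃ g : SL(2, A), g.1 = !![v 0 0, ↑d⁻¹ * v 1 0; v 0 1, ↑d⁻¹ * v 1 1] := by
    refine ⟨⟨_, ?_⟩, rfl⟩
    rw [Matrix.det_fin_two]
    simp only [Matrix.of_apply, Matrix.cons_val', Matrix.cons_val_zero, Matrix.cons_val_one,
      Matrix.cons_val_fin_one]
    linear_combination ((d⁻¹ : Aˣ) : A) * (-hd) + hd'
  refine ⟨g, ?_⟩
  ext i : 2
  rw [line_smul, h2, hg]
  fin_cases i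
  · refine map_span_mulVecLin _ ![1, 0] (v 0) 1 isUnit_one ?_
    funext j; fin_cases j <;> simp [Matrix.mulVec, dotProduct]
  · refine map_span_mulVecLin _ ![0, 1] (v 1) _ d⁻¹.isUnit ?_
    funext j; fin_cases j <;> simp [Matrix.mulVec, dotProduct]

instance isPretransitive_one : MulAction.IsPretransitive PSL(2, A) (Simplex A 1) where
  exists_smul_eq p q := by
    obtain ⟨g, rfl⟩ := exists_smul_edge p
    obtain ⟨h, rfl⟩ := exists_smul_edge q
    exact ⟨(QuotientGroup.mk h : PSL(2, A)) * (QuotientGroup.mk g : PSL(2, A))⁻¹,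
      by rw [mul_smul, inv_smul_smul]⟩

theorem face_one_surjective : Function.Surjective (face 1 : Simplex A 1 → Simplex A 0) := by
  intro p
  obtain ⟨v, h1, h2, h3⟩ := p.exists_vec
  obtain ⟨a, b, hab⟩ := h1 0
  -- Bézout coefficients a, b of the unimodular vector v₀ complete it to the matrix with columns v₀
  -- and (-b, a), of determinant 1.
  refine ⟨edgeOfVec (v 0) ![-b, a] (h1 0) ⟨-v 0 1, v 0 0, ?_⟩ ?_, ?_⟩
  · simp; linear_combination hab
  · have : v 0 0 * (![-b, a] : Fin 2 → A) 1 - (![-b, a] : Fin 2 → A) 0 * v 0 1 = 1 := by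
      simp; linear_combination hab
    rw [this]; exact isUnit_one
  · ext i : 2
    fin_cases i
    exact (h2 0).symm

instance : MulAction.IsPretransitive PSL(2, A) (Simplex A 0) where
  exists_smul_eq p q := by
    obtain ⟨p, rfl⟩ := face_one_surjective p
    obtain ⟨q, rfl⟩ := face_one_surjective q
    obtain ⟨g, rfl⟩ := @MulAction.exists_smul_eq PSL(2, A) (Simplex A 1) _ isPretransitive_one p q
    exact ⟨g, (face_psl 1 g p).symm⟩

theorem map_infty_eq_iff (g : SL(2, A)) :
    (Submodule.span A {(![1, 0] : Fin 2 → A)}).map g.1.mulVecLin = Submodule.span A {![1, 0]} ↔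
      g 1 0 = 0 := by
  have hdet := g.det_coe
  rw [Matrix.det_fin_two] at hdet
  constructor
  · intro h
    have h1 : g.1.mulVec ![1, 0] ∈ Submodule.span A {(![1, 0] : Fin 2 → A)} := by
      rw [← h]
      exact Submodule.mem_map_of_mem (Submodule.mem_span_singleton_self _)
    obtain ⟨c, hc⟩ := Submodule.mem_span_singleton.1 h1
    have := congrFun hc 1
    simpa [Matrix.mulVec, dotProduct] using this.symm
  · intro h
    rw [h, mul_zero, sub_zero] at hdet
    refine map_span_mulVecLin _ _ _ (g 0 0) (IsUnit.of_mul_eq_one _ hdet) ?_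
    funext j; fin_cases j <;> simp [Matrix.mulVec, dotProduct, h]

theorem map_zero_eq_iff (g : SL(2, A)) :
    (Submodule.span A {(![0, 1] : Fin 2 → A)}).map g.1.mulVecLin = Submodule.span A {![0, 1]} ↔
      g 0 1 = 0 := by
  have hdet := g.det_coe
  rw [Matrix.det_fin_two] at hdet
  constructor
  · intro h
    have h1 : g.1.mulVec ![0, 1] ∈ Submodule.span A {(![0, 1] : Fin 2 → A)} := by
      rw [← h]
      exact Submodule.mem_map_of_mem (Submodule.mem_span_singleton_self _)
    obtain ⟨c, hc⟩ := Submodule.mem_span_singleton.1 h1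
    have := congrFun hc 0
    simpa [Matrix.mulVec, dotProduct] using this.symm
  · intro h
    rw [h, zero_mul, sub_zero, mul_comm] at hdet
    refine map_span_mulVecLin _ _ _ (g 1 1) (IsUnit.of_mul_eq_one _ hdet) ?_
    funext j; fin_cases j <;> simp [Matrix.mulVec, dotProduct, h]

theorem mem_PT_iff (g : PSL(2, A)) : g ∈ PT A ↔ g • edge A = edge A := by
  obtain ⟨g, rfl⟩ := QuotientGroup.mk_surjective g
  rw [mk_mem_proj center_le_T, Simplex.ext_iff, funext_iff, Fin.forall_fin_two, line_smul,
    line_smul]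
  exact and_comm.trans (and_congr (map_infty_eq_iff g) (map_zero_eq_iff g)).symm

theorem mem_PB_iff (g : PSL(2, A)) : g ∈ PB A ↔ g • face 1 (edge A) = face 1 (edge A) := by
  obtain ⟨g, rfl⟩ := QuotientGroup.mk_surjective g
  rw [mk_mem_proj center_le_B, Simplex.ext_iff, funext_iff, Fin.forall_fin_one, line_smul]
  exact (map_infty_eq_iff g).symm

/-- The class of the matrix with rows `(0, 1)` and `(-1, 0)`. -/
def wSL : SL(2, A) := ⟨!![0, 1; -1, 0], by simp [Matrix.det_fin_two]⟩

theorem wSL_mem : (wSL : SL(2, A)) ∈ SM A := Or.inr ⟨rfl, rfl⟩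

theorem wSL_smul_edge : (QuotientGroup.mk wSL : PSL(2, A)) • edge A = swap (edge A) := by
  ext i : 2
  rw [line_smul]
  fin_cases i
  · refine map_span_mulVecLin _ ![1, 0] ![0, 1] (-1) isUnit_one.neg ?_
    funext j; fin_cases j <;> simp [Matrix.mulVec, dotProduct, wSL]
  · refine map_span_mulVecLin _ ![0, 1] ![1, 0] 1 isUnit_one ?_
    funext j; fin_cases j <;> simp [Matrix.mulVec, dotProduct, wSL]

theorem SM_cases {g : SL(2, A)} (hg : g ∈ SM A) : g ∈ T A ∨ wSL⁻¹ * g ∈ T A := by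
  rcases hg with h | ⟨h1, h2⟩
  · exact Or.inl h
  · refine Or.inr ?_
    constructor <;> simp [Matrix.mul_apply, Fin.sum_univ_two, h1, h2] <;>
      simp [wSL, Matrix.adjugate_fin_two]

theorem smul_edge_of_mem_PSM {g : PSL(2, A)} (hg : g ∈ PSM A) :
    g • edge A = edge A ∨ g • edge A = swap (edge A) := by
  obtain ⟨g, rfl⟩ := QuotientGroup.mk_surjective g
  rw [mk_mem_proj center_le_SM] at hg
  rcases SM_cases hg with h | h
  · exact Or.inl ((mem_PT_iff _).1 ((mk_mem_proj center_le_T _).2 h))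
  · refine Or.inr ?_
    have h' := (mem_PT_iff _).1 ((mk_mem_proj center_le_T _).2 h)
    rw [QuotientGroup.mk_mul, QuotientGroup.mk_inv, mul_smul, inv_smul_eq_iff] at h'
    rw [h', wSL_smul_edge]

theorem PT_le_PSM : PT A ≤ PSM A := Subgroup.map_mono fun _ h => Or.inl h

/-- The action of `PSL_2(A)` on triples is free. -/
theorem eq_one_of_smul_eq (g : PSL(2, A)) (p : Simplex A 2) (h : g • p = p) : g = 1 := by
  -- After conjugation the first two lines of the triple are ∞ and 0, so the stabilizing matrix is
  -- diagonal.
  obtain ⟨h₀, hh⟩ := exists_smul_edge (face 2 p)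
  set t : PSL(2, A) := QuotientGroup.mk h₀
  set p' := t⁻¹ • p
  have hp' : face 2 p' = edge A := by rw [face_psl, ← hh, inv_smul_smul]
  have h' : (t⁻¹ * g * t) • p' = p' := by
    rw [mul_smul, mul_smul, smul_inv_smul, h]
  suffices hs : t⁻¹ * g * t = 1 by
    rw [mul_assoc, inv_mul_eq_one] at hs
    exact (mul_eq_right.1 hs.symm)
  obtain ⟨m, hm⟩ := QuotientGroup.mk_surjective (t⁻¹ * g * t)
  rw [← hm] at h' ⊢
  have hT : m ∈ T A := by
    rw [← mk_mem_proj center_le_T, mem_PT_iff, ← hp', ← face_psl, h']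
  rw [QuotientGroup.eq_one_iff]
  refine mem_center_of_scalar A ?_ hT.1 hT.2
  obtain ⟨v, h1, h2, h3⟩ := p'.exists_vec
  have hv0 : v 0 ∈ Submodule.span A {(![1, 0] : Fin 2 → A)} := by
    have : p'.line 0 = Submodule.span A {(![1, 0] : Fin 2 → A)} :=
      congrFun (congrArg Simplex.line hp') 0
    rw [← this, h2]; exact Submodule.mem_span_singleton_self _
  have hv1 : v 1 ∈ Submodule.span A {(![0, 1] : Fin 2 → A)} := by
    have : p'.line 1 = Submodule.span A {(![0, 1] : Fin 2 → A)} :=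
      congrFun (congrArg Simplex.line hp') 1
    rw [← this, h2]; exact Submodule.mem_span_singleton_self _
  obtain ⟨a, ha⟩ := Submodule.mem_span_singleton.1 hv0
  obtain ⟨b, hb⟩ := Submodule.mem_span_singleton.1 hv1
  -- The third line forms a basis with ∞ and with 0, so both coordinates of its generator are units.
  -- Preserving that line forces equal diagonal entries, hence a central matrix.
  have hu1 : IsUnit (v 2 1) := by
    have := isUnit_of_isBasisPair (h3 0 2 (by simp))
    rw [← ha] at this
    exact isUnit_of_mul_isUnit_right (by simpa using this)
  have hu0 : IsUnit (v 2 0) := by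
    have := isUnit_of_isBasisPair (h3 1 2 (by simp))
    rw [← hb] at this
    exact isUnit_of_mul_isUnit_left (by simpa using this)
  have hm2 : m.1.mulVec (v 2) ∈ Submodule.span A {v 2} := by
    have : (Submodule.span A {v 2}).map m.1.mulVecLin = Submodule.span A {v 2} := by
      rw [← h2, ← line_smul, h']
    rw [← this]
    exact Submodule.mem_map_of_mem (Submodule.mem_span_singleton_self _)
  obtain ⟨c, hc⟩ := Submodule.mem_span_singleton.1 hm2
  have hc0 := congrFun hc 0
  have hc1 := congrFun hc 1
  simp only [Matrix.mulVec, dotProduct, Fin.sum_univ_two, Pi.smul_apply, smul_eq_mul, hT.1, hT.2,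
    zero_mul, add_zero, zero_add] at hc0 hc1
  rw [← hu0.mul_left_inj.1 hc0, ← hu1.mul_left_inj.1 hc1]

end Simplices

end RefinedScissors

/-! ### The retraction of PB onto PT -/

namespace RefinedScissors

section Retraction

variable {A : Type u} [CommRing A]

/-- The diagonal part of an upper triangular matrix. -/
def diagPart : B A →* T A where
  toFun g := ⟨⟨!![g.1 0 0, 0; 0, g.1 1 1], by
    have h := g.1.det_coe
    rw [Matrix.det_fin_two, show g.1 1 0 = 0 from g.2, mul_zero, sub_zero] at h
    simpa [Matrix.det_fin_two] using h⟩, rfl, rfl⟩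
  map_one' := by
    ext i j; fin_cases i <;> fin_cases j <;> simp
  map_mul' g h := by
    have hg : g.1 1 0 = 0 := g.2
    have hh : h.1 1 0 = 0 := h.2
    refine Subtype.ext (Matrix.SpecialLinearGroup.ext _ _ fun i j => ?_)
    change _ = (!![g.1 0 0, 0; 0, g.1 1 1] * !![h.1 0 0, 0; 0, h.1 1 1]) i j
    fin_cases i <;> fin_cases j <;> simp [Matrix.mul_apply, Fin.sum_univ_two, hg, hh]

theorem diagPart_inclusion (g : T A) (hg : g.1 ∈ B A) : diagPart ⟨g.1, hg⟩ = g := by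
  have h1 : g.1 0 1 = 0 := g.2.1
  have h2 : g.1 1 0 = 0 := g.2.2
  ext i j
  fin_cases i <;> fin_cases j <;> simp [diagPart, h1, h2]

variable (A) in
/-- `PT(A)` is a retract of `PB(A)`. -/
theorem exists_retraction :
    ∃ r : PB A →* PT A, r.comp (Subgroup.inclusion (PT_le_PB A)) = MonoidHom.id _ := by
  let π := QuotientGroup.mk' (Subgroup.center SL(2, A))
  let f : B A →* PB A := π.subgroupMap (B A)
  have hf : Function.Surjective f := π.subgroupMap_surjective (B A)
  let r : PB A →* PT A := f.liftOfSurjective hf ⟨(π.subgroupMap (T A)).comp diagPart, by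
    intro g hg
    have hg' : g.1 ∈ Subgroup.center SL(2, A) :=
      (QuotientGroup.eq_one_iff _).1 (congrArg Subtype.val hg)
    refine Subtype.ext ((QuotientGroup.eq_one_iff (diagPart g).1).2 ?_)
    rwa [diagPart_inclusion ⟨g.1, center_le_T hg'⟩ g.2]⟩
  refine ⟨r, MonoidHom.ext ?_⟩
  rintro ⟨_, t, ht, rfl⟩
  have h : r (f ⟨t, ht.2⟩) = π.subgroupMap (T A) (diagPart ⟨t, ht.2⟩) :=
    MonoidHom.liftOfRightInverse_comp_apply _ _ _ _ _
  exact h.trans (congrArg _ (diagPart_inclusion ⟨t, ht⟩ ht.2))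

theorem homologyMapZ_comp {G H K : Type u} [Group G] [Group H] [Group K] (f : H →* G) (g : K →* H)
    (n : ℕ) : homologyMapZ (f.comp g) n = homologyMapZ g n ≫ homologyMapZ f n := by
  have := groupHomology.map_comp (A := trivZ K) (B := trivZ H) (C := trivZ G) g f
    (𝟙 (trivZ K)) (𝟙 (trivZ H)) n
  exact this

theorem homologyMapZ_id (G : Type u) [Group G] (n : ℕ) :
    homologyMapZ (MonoidHom.id G) n = 𝟙 _ :=
  groupHomology.map_id (A := trivZ G) n

/-- A retract induces a split injection. Only degree 1 is needed; the hypothesis covers degrees 2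
and 3. -/
theorem injective_homologyMapZ_PT (n : ℕ) :
    Function.Injective (homologyMapZ (Subgroup.inclusion (PT_le_PB A)) n) := by
  obtain ⟨r, hr⟩ := exists_retraction A
  have h : homologyMapZ (Subgroup.inclusion (PT_le_PB A)) n ≫ homologyMapZ r n = 𝟙 _ := by
    rw [← homologyMapZ_comp, hr, homologyMapZ_id]
  exact Function.LeftInverse.injective fun x => congr($h x)

end Retraction

/-! ### Unordered edges as cosets of PSM -/

section Quotient

variable {A : Type u} [CommRing A]

/-- The map which sends the edge `g • (∞, 0)` to the class of `g` modulo `PSM_2(A)`. -/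
def edgeClass (p : Simplex A 1) : PSL(2, A) ⧸ PSM A :=
  QuotientGroup.mk (QuotientGroup.mk (exists_smul_edge p).choose : PSL(2, A))

theorem exists_psl_smul_edge (p : Simplex A 1) : ∃ g : PSL(2, A), g • edge A = p :=
  ⟨_, (exists_smul_edge p).choose_spec⟩

theorem edgeClass_smul_edge (g : PSL(2, A)) : edgeClass (g • edge A) = QuotientGroup.mk g := by
  refine QuotientGroup.eq.2 (PT_le_PSM ((mem_PT_iff _).2 ?_))
  rw [mul_smul, inv_smul_eq_iff]
  exact (exists_smul_edge (g • edge A)).choose_spec.symm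

theorem edgeClass_edge : edgeClass (edge A) = QuotientGroup.mk 1 := by
  rw [← edgeClass_smul_edge, one_smul]

theorem edgeClass_smul (g : PSL(2, A)) (p : Simplex A 1) :
    edgeClass (g • p) = g • edgeClass p := by
  obtain ⟨h, rfl⟩ := exists_psl_smul_edge p
  rw [← mul_smul, edgeClass_smul_edge, edgeClass_smul_edge]
  rfl

theorem edgeClass_swap (p : Simplex A 1) : edgeClass (swap p) = edgeClass p := by
  obtain ⟨h, rfl⟩ := exists_psl_smul_edge p
  rw [swap_smul, ← wSL_smul_edge, ← mul_smul, edgeClass_smul_edge, edgeClass_smul_edge]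
  exact QuotientGroup.mk_mul_of_mem h ⟨_, wSL_mem, rfl⟩

/-- PSM consists of the elements that fix or reverse the edge (∞, 0), so the fibres of `edgeClass`
are the swap orbits and PSL_2(A)/PSM is the set of unordered edges. -/
theorem eq_or_eq_swap {p p' : Simplex A 1} (h : edgeClass p = edgeClass p') :
    p' = p ∨ p' = swap p := by
  obtain ⟨g, rfl⟩ := exists_psl_smul_edge p
  obtain ⟨g', rfl⟩ := exists_psl_smul_edge p'
  rw [edgeClass_smul_edge, edgeClass_smul_edge] at h
  rw [swap_smul, ← inv_smul_eq_iff, ← inv_smul_eq_iff, ← mul_smul]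
  exact smul_edge_of_mem_PSM (QuotientGroup.eq.1 h)

theorem edgeClass_surjective : Function.Surjective (edgeClass (A := A)) := fun w => by
  obtain ⟨g, rfl⟩ := QuotientGroup.mk_surjective w
  exact ⟨g • edge A, edgeClass_smul_edge g⟩

theorem mem_PSM_iff (g : PSL(2, A)) :
    g ∈ PSM A ↔ g • edgeClass (edge A) = edgeClass (edge A) := by
  rw [edgeClass_edge, eq_comm]
  refine Iff.trans ?_ (QuotientGroup.eq (s := PSM A) (a := 1) (b := g * 1)).symm
  simp

end Quotient

/-! ### Chains of edges and the interchange of lines -/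

section Chains

variable {A : Type u} [CommRing A] {M : Type*} [AddCommGroup M]

/-- The boundary of `2`-chains with coefficients in `M`. -/
def bdryTwo (x : Simplex A 2 →₀ M) : Simplex A 1 →₀ M :=
  Finsupp.mapDomain (face 0) x - Finsupp.mapDomain (face 1) x + Finsupp.mapDomain (face 2) x

/-- Replacing every edge by a chosen orientation r changes the chain by terms p - swap p, and the
reoriented chain is determined by its image under `edgeClass`, here 0. -/
theorem exists_sub_swap (y : Simplex A 1 →₀ M) (hy : Finsupp.mapDomain edgeClass y = 0) :
    ∃ x, y = x - Finsupp.mapDomain swap x := by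
  let r : PSL(2, A) ⧸ PSM A → Simplex A 1 := Function.surjInv edgeClass_surjective
  suffices h : ∀ y : Simplex A 1 →₀ M, ∃ x,
      y - Finsupp.mapDomain r (Finsupp.mapDomain edgeClass y) = x - Finsupp.mapDomain swap x by
    simpa [hy] using h y
  intro y
  induction y using Finsupp.induction_linear with
  | zero => exact ⟨0, by simp⟩
  | add y y' hy hy' =>
    obtain ⟨x, hx⟩ := hy
    obtain ⟨x', hx'⟩ := hy'
    refine ⟨x + x', ?_⟩
    rw [Finsupp.mapDomain_add, Finsupp.mapDomain_add, Finsupp.mapDomain_add, add_sub_add_comm, hx,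
      hx', add_sub_add_comm]
  | single p m =>
    rw [Finsupp.mapDomain_single, Finsupp.mapDomain_single]
    have : edgeClass p = edgeClass (r (edgeClass p)) := (Function.surjInv_eq _ _).symm
    rcases eq_or_eq_swap this with h | h
    · exact ⟨0, by rw [h]; simp⟩
    · exact ⟨Finsupp.single p m, by rw [h, Finsupp.mapDomain_single]⟩

theorem mapDomain_face_one_swap (x : Simplex A 1 →₀ M) :
    Finsupp.mapDomain (face 1) (Finsupp.mapDomain swap x) = Finsupp.mapDomain (face 0) x := by
  rw [← Finsupp.mapDomain_comp, show face 1 ∘ swap = face 0 from funext face_one_swap]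

theorem mapDomain_edgeClass_swap (x : Simplex A 1 →₀ M) :
    Finsupp.mapDomain edgeClass (Finsupp.mapDomain swap x) = Finsupp.mapDomain edgeClass x := by
  rw [← Finsupp.mapDomain_comp, show edgeClass ∘ swap = edgeClass from funext edgeClass_swap]

theorem mapDomain_face_bdryTwo (x : Simplex A 2 →₀ M) :
    Finsupp.mapDomain (face 1) (bdryTwo x) = Finsupp.mapDomain (face 0) (bdryTwo x) := by
  have h00 : (face 0 ∘ face 0 : Simplex A 2 → Simplex A 0) = face 0 ∘ face 1 := by
    funext p; ext i : 2; fin_cases i; rfl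
  have h10 : (face 1 ∘ face 0 : Simplex A 2 → Simplex A 0) = face 0 ∘ face 2 := by
    funext p; ext i : 2; fin_cases i; rfl
  have h11 : (face 1 ∘ face 1 : Simplex A 2 → Simplex A 0) = face 1 ∘ face 2 := by
    funext p; ext i : 2; fin_cases i; rfl
  simp only [bdryTwo, Finsupp.mapDomain_add, Finsupp.mapDomain_sub, ← Finsupp.mapDomain_comp, h00,
    h10, h11]
  abel

theorem bdry_zero_apply (x : X A 1) :
    bdry A 0 x = Finsupp.mapDomain (face 0) x - Finsupp.mapDomain (face 1) x := by
  rw [bdry, LinearMap.sum_apply, Fin.sum_univ_two]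
  simp [sub_eq_add_neg]

theorem bdry_one_apply (x : X A 2) : bdry A 1 x = bdryTwo x := by
  rw [bdry, LinearMap.sum_apply, Fin.sum_univ_three]
  simp [bdryTwo, sub_eq_add_neg]

variable (A) in
/-- Integral chains, in the universe of `A`. -/
def chainEquiv (n : ℕ) : X A n ≃+ (Simplex A n →₀ ULift.{u} ℤ) :=
  Finsupp.mapRange.addEquiv AddEquiv.ulift.symm

theorem chainEquiv_single (n : ℕ) (p : Simplex A n) (m : ℤ) :
    chainEquiv A n (Finsupp.single p m) = Finsupp.single p (ULift.up m) :=
  Finsupp.mapRange_single (hf := rfl)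

theorem chainEquiv_mapDomain {n m : ℕ} (f : Simplex A n → Simplex A m) (x : X A n) :
    chainEquiv A m (Finsupp.mapDomain f x) = Finsupp.mapDomain f (chainEquiv A n x) :=
  (Finsupp.mapDomain_mapRange f x ULift.up rfl fun _ _ => rfl).symm

theorem bdryTwo_chainEquiv (x : X A 2) :
    bdryTwo (chainEquiv A 2 x) = chainEquiv A 1 (bdryTwo x) := by
  simp only [bdryTwo, map_add, map_sub, chainEquiv_mapDomain]

theorem exists_bdryTwo (hX : ExactBelowTwo A) (y : Simplex A 1 →₀ ULift.{u} ℤ)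
    (hy : Finsupp.mapDomain (face 1) y = Finsupp.mapDomain (face 0) y) : ∃ x, bdryTwo x = y := by
  obtain ⟨y, rfl⟩ := (chainEquiv A 1).surjective y
  have h : bdry A 0 y = 0 := by
    rw [bdry_zero_apply, sub_eq_zero]
    rw [← chainEquiv_mapDomain, ← chainEquiv_mapDomain] at hy
    exact ((chainEquiv A 0).injective hy).symm
  obtain ⟨x, rfl⟩ := (hX.2.2 y).1 h
  exact ⟨chainEquiv A 2 x, by rw [bdryTwo_chainEquiv, bdry_one_apply]⟩

end Chains

/-! ### The relative group as a kernel between coinvariants -/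

section Homology

open PermRep

variable {A : Type u} [CommRing A]

theorem permSum_chainEquiv (x : X A 0) :
    (permSum (Simplex A 0) (trivZ PSL(2, A))).hom (chainEquiv A 0 x) = ULift.up (aug A x) := by
  induction x using Finsupp.induction_linear with
  | zero =>
    rw [map_zero, map_zero, map_zero]
    rfl
  | add x y hx hy =>
    rw [map_add (chainEquiv A 0), map_add (aug A)]
    refine (map_add (permSum (Simplex A 0) (trivZ PSL(2, A))).hom _ _).trans ?_
    rw [hx, hy]
    rfl
  | single p m =>
    rw [chainEquiv_single]
    refine (permSum_single (M := trivZ PSL(2, A)) p _).trans ?_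
    simp [aug]

variable (A) in
/-- The map from edges to the kernel of `ℤ[edges] → ℤ[lines]` and then to the augmentation kernel of
`ℤ[PSL_2(A)/PSM_2(A)]`. -/
abbrev edgeMap := kerToAugKer (G := PSL(2, A)) edgeClass edgeClass_smul
  (face 1 : Simplex A 1 → Simplex A 0) (face_psl 1)

/-- A lift x₀ of v has a chain of first lines of augmentation 0, hence equal to ∂z by exactness at
X_0. The chain swap z - z has the same first lines and dies in ℤ[PSL_2(A)/PSM], so subtracting it
moves the lift into the kernel. -/
theorem edgeMap_surjective (hX : ExactBelowTwo A) : Function.Surjective (edgeMap A).hom := by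
  rintro ⟨v, hv⟩
  obtain ⟨x₀, rfl⟩ := Finsupp.mapDomain_surjective edgeClass_surjective v
  have h0 : (permSum (Simplex A 0) (trivZ PSL(2, A))).hom
      (Finsupp.mapDomain (face 1) x₀ : Simplex A 0 →₀ ULift.{u} ℤ) = 0 :=
    ((permSum_mapDomain (M := trivZ PSL(2, A)) (face 1) x₀).trans
      (permSum_mapDomain (M := trivZ PSL(2, A)) edgeClass x₀).symm).trans hv
  obtain ⟨y, hy⟩ := (chainEquiv A 0).surjective (Finsupp.mapDomain (face 1) x₀)
  rw [← hy] at h0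
  obtain ⟨z, hz⟩ := (hX.2.1 y).1 (congrArg ULift.down ((permSum_chainEquiv y).symm.trans h0))
  let z' := chainEquiv A 1 z
  have hz' : Finsupp.mapDomain (face 1) x₀ =
      Finsupp.mapDomain (face 0) z' - Finsupp.mapDomain (face 1) z' := by
    rw [← hy, ← hz, bdry_zero_apply, map_sub, chainEquiv_mapDomain, chainEquiv_mapDomain]
  refine ⟨⟨x₀ - (Finsupp.mapDomain swap z' - z'), ?_⟩, Subtype.ext ?_⟩
  · change Finsupp.mapDomain (face 1) (x₀ - (Finsupp.mapDomain swap z' - z')) = 0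
    rw [Finsupp.mapDomain_sub, Finsupp.mapDomain_sub, mapDomain_face_one_swap, hz', sub_self]
  · change Finsupp.mapDomain edgeClass (x₀ - (Finsupp.mapDomain swap z' - z')) = _
    rw [Finsupp.mapDomain_sub, Finsupp.mapDomain_sub, mapDomain_edgeClass_swap, sub_self, sub_zero]

variable (A) in
/-- The boundary of `2`-chains as a morphism of representations. -/
def bdryRep : perm (Simplex A 2) (trivZ PSL(2, A)) ⟶ perm (Simplex A 1) (trivZ PSL(2, A)) :=
  permMap _ (face 0) (face_psl 0) - permMap _ (face 1) (face_psl 1)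
    + permMap _ (face 2) (face_psl 2)

variable (A) in
/-- The map `x ↦ ∂x - swap (∂x)`. -/
def altBdry : perm (Simplex A 2) (trivZ PSL(2, A)) ⟶ ker (edgeMap A) :=
  kerLift _ (kerLift _ (bdryRep A - bdryRep A ≫ permMap _ swap swap_smul) fun x => by
    change Finsupp.mapDomain (face 1) (bdryTwo (M := ULift.{u} ℤ) x -
      Finsupp.mapDomain swap (bdryTwo x)) = 0
    rw [Finsupp.mapDomain_sub, mapDomain_face_one_swap, mapDomain_face_bdryTwo, sub_self])
    fun x => by
    refine Subtype.ext ?_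
    change Finsupp.mapDomain edgeClass (bdryTwo (M := ULift.{u} ℤ) x -
      Finsupp.mapDomain swap (bdryTwo x)) = 0
    rw [Finsupp.mapDomain_sub, mapDomain_edgeClass_swap, sub_self]

theorem altBdry_apply (x : Simplex A 2 →₀ ULift.{u} ℤ) :
    ((altBdry A).hom x).1.1 = bdryTwo x - Finsupp.mapDomain swap (bdryTwo x) := rfl

theorem mem_ker_altBdry_iff (x : Simplex A 2 →₀ ULift.{u} ℤ) :
    (altBdry A).hom x = 0 ↔ Finsupp.mapDomain swap (bdryTwo x) = bdryTwo x := by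
  rw [eq_comm (a := Finsupp.mapDomain _ _), ← sub_eq_zero (b := Finsupp.mapDomain _ _),
    ← altBdry_apply]
  exact ⟨fun h => by rw [h]; rfl, fun h => Subtype.ext (Subtype.ext h)⟩

/-- An element of the kernel has the form x - swap x. Vanishing of its first lines says that the two
endpoint chains of x agree, so x is a 1-cycle and bounds by exactness at X_1. -/
theorem altBdry_surjective (hX : ExactBelowTwo A) : Function.Surjective (altBdry A).hom := by
  rintro ⟨⟨y, hy⟩, hy'⟩
  obtain ⟨x, rfl⟩ := exists_sub_swap (M := ULift.{u} ℤ) y (congrArg Subtype.val hy')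
  have hx : Finsupp.mapDomain (face 1) (x - Finsupp.mapDomain swap x) = 0 := hy
  rw [Finsupp.mapDomain_sub, mapDomain_face_one_swap, sub_eq_zero] at hx
  obtain ⟨z, rfl⟩ := exists_bdryTwo hX x hx
  exact ⟨z, rfl⟩

/-- The relative homology group `H_3(PSL_2(A), PSM_2(A))` in terms of coinvariants. -/
theorem relHomology_PSM_equiv (hX : ExactBelowTwo A)
    (hPB : ∀ i : ℕ, i = 2 ∨ i = 3 → Function.Bijective
      (homologyMapZ (Subgroup.inclusion (PT_le_PB A)) i)) :
    Nonempty (relHomology (PSM A) 3 ≃+ (coinvMap (kerι (altBdry A))).ker) :=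
  relHomology_equiv_ker _ _ _ _ (edge A) face_one_surjective mem_PT_iff mem_PSM_iff mem_PB_iff
    (PT_le_PB A) (injective_homologyMapZ_PT 1) (hPB 2 (Or.inl rfl)) (hPB 3 (Or.inr rfl))
    (edgeMap_surjective hX) (altBdry A) (altBdry_surjective hX)
    (isZero_groupHomology_perm_of_free _ eq_one_of_smul_eq 0)

end Homology

end RefinedScissors

/-! ### The elements ψ(a) and their translates -/

namespace RefinedScissors

section Act

variable {A : Type u} [CommRing A]

/-- The action of `PSL_2(A)` on integral chains. -/
def act {n : ℕ} (g : PSL(2, A)) : X A n →ₗ[ℤ] X A n := Finsupp.lmapDomain ℤ ℤ (g • ·)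

@[simp]
theorem act_single {n : ℕ} (g : PSL(2, A)) (p : Simplex A n) (m : ℤ) :
    act g (Finsupp.single p m) = Finsupp.single (g • p) m := Finsupp.mapDomain_single

theorem act_mk {n : ℕ} (g : SL(2, A)) (x : X A n) :
    act (QuotientGroup.mk g : PSL(2, A)) x =
      XRep A n (Matrix.SpecialLinearGroup.toGL g) x := rfl

theorem act_mul {n : ℕ} (g h : PSL(2, A)) (x : X A n) : act (g * h) x = act g (act h x) := by
  induction x using Finsupp.induction_linear with
  | zero => simp
  | add x y hx hy => rw [map_add, map_add, map_add, hx, hy]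
  | single p m => simp [mul_smul]

theorem bdry_act (n : ℕ) (g : PSL(2, A)) (x : X A (n + 1)) :
    bdry A n (act g x) = act g (bdry A n x) := by
  obtain ⟨g, rfl⟩ := QuotientGroup.mk_surjective g
  exact bdry_XRep A n _ x

theorem act_mem (g : PSL(2, A)) {z : X A 2} (hz : z ∈ Z₂ A) : act g z ∈ Z₂ A := by
  change bdry A 1 (act g z) = 0
  rw [bdry_act, show bdry A 1 z = 0 from hz, map_zero]

variable (A) in
/-- The interchange of the two lines of the edges of a chain. -/
def swapChain : X A 1 →ₗ[ℤ] X A 1 := Finsupp.lmapDomain ℤ ℤ swap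

@[simp]
theorem swapChain_single (p : Simplex A 1) (m : ℤ) :
    swapChain A (Finsupp.single p m) = Finsupp.single (swap p) m := Finsupp.mapDomain_single

theorem swapChain_act (g : PSL(2, A)) (y : X A 1) :
    swapChain A (act g y) = act g (swapChain A y) := by
  induction y using Finsupp.induction_linear with
  | zero => simp
  | add x y hx hy => simp only [map_add, hx, hy]
  | single p m => simp [swap_smul]

end Act

section Classes

variable {A : Type u} [CommRing A]

/-- The class of a cycle in `ℛ𝒫(A)`. -/
def cls : Z₂ A →+ RP A :=
  (RPRep A).asModuleEquiv.symm.toAddMonoidHom.comp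
    (Representation.Coinvariants.mk
      (MonoidHom.comp (ZRep A) (SLsub A).subtype)).toAddMonoidHom

theorem cls_surjective : Function.Surjective (cls (A := A)) :=
  (RPRep A).asModuleEquiv.symm.surjective.comp (Representation.Coinvariants.mk_surjective _)

theorem cls_ZRep_of_det (g : GL (Fin 2) A) (hg : Matrix.GeneralLinearGroup.det g = 1) (z : Z₂ A) :
    cls (ZRep A g z) = cls z :=
  Representation.Coinvariants.mk_self_apply (MonoidHom.comp (ZRep A) (SLsub A).subtype) ⟨g, hg⟩ z

theorem cls_act (g : PSL(2, A)) {z : X A 2} (hz : z ∈ Z₂ A) :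
    cls ⟨act g z, act_mem g hz⟩ = cls ⟨z, hz⟩ := by
  obtain ⟨g, rfl⟩ := QuotientGroup.mk_surjective g
  exact cls_ZRep_of_det (Matrix.SpecialLinearGroup.toGL g) (Units.ext (by simp)) ⟨z, hz⟩

theorem cls_diagUnit (a : Aˣ) (z : Z₂ A) :
    cls (ZRep A (diagUnit A a) z) =
      MonoidAlgebra.of ℤ (SqClass A) (QuotientGroup.mk a) • cls z := by
  exact (RPRep A).asModuleEquiv_symm_map_rho (QuotientGroup.mk a)
    (Representation.Coinvariants.mk (MonoidHom.comp (ZRep A) (SLsub A).subtype) z)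

theorem psi_eq_cls (a : Aˣ) : psi a = cls ⟨psiChain a, psiChain_mem a⟩ := rfl

/-- The chain `(∞, 0, a) + (0, ∞, a)`. -/
def symChainAt (a : Aˣ) : X A 2 :=
  Finsupp.single (triInfZero a) 1 + Finsupp.single (triZeroInf a) 1

theorem psiChain_eq (a : Aˣ) : psiChain a = symChainAt a - symChainAt 1 := by
  rw [psiChain, symChainAt, symChainAt, sub_sub]

theorem map_line (m : GL (Fin 2) A) {v w : Fin 2 → A} (c : Aˣ) (h : m.1.mulVec v = (c : A) • w) :
    (Submodule.span A {v}).map m.1.mulVecLin = Submodule.span A {w} :=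
  map_span_mulVecLin _ _ _ _ c.isUnit h

/-- Diagonal matrices `diag(c, d)` permute the triples `(∞, 0, a)` and `(0, ∞, a)`. -/
theorem XRep_diag_symChainAt (m : GL (Fin 2) A) (c d a b : Aˣ)
    (hm : m.1 = !![(c : A), 0; 0, (d : A)])
    (h : (d : A) * a = c * b) : XRep A 2 m (symChainAt a) = symChainAt b := by
  have h0 : m.1.mulVec ![1, 0] = (c : A) • ![1, 0] := by
    funext j; fin_cases j <;> simp [hm, Matrix.mulVec, dotProduct]
  have h1 : m.1.mulVec ![0, 1] = (d : A) • ![0, 1] := by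
    funext j; fin_cases j <;> simp [hm, Matrix.mulVec, dotProduct]
  have h2 : m.1.mulVec ![1, (a : A)] = (c : A) • ![1, (b : A)] := by
    funext j; fin_cases j <;> simp [hm, Matrix.mulVec, dotProduct, h]
  have e1 : m • triInfZero a = triInfZero b := by
    ext i : 2
    fin_cases i
    exacts [map_line m c h0, map_line m d h1, map_line m c h2]
  have e2 : m • triZeroInf a = triZeroInf b := by
    ext i : 2
    fin_cases i
    exacts [map_line m d h1, map_line m c h0, map_line m c h2]
  rw [symChainAt, map_add, XRep_single, XRep_single, e1, e2, symChainAt]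

theorem wMat_smul_triZeroInf (a b : Aˣ) (h : (b : A) * a = -1) :
    (wMat : GL (Fin 2) A) • triZeroInf a = triInfZero b := by
  have h0 : (wMat : GL (Fin 2) A).1.mulVec ![1, 0] = ((-1 : Aˣ) : A) • ![0, 1] := by
    funext j; fin_cases j <;> simp [wMat, Matrix.mulVec, dotProduct]
  have h1 : (wMat : GL (Fin 2) A).1.mulVec ![0, 1] = ((1 : Aˣ) : A) • ![1, 0] := by
    funext j; fin_cases j <;> simp [wMat, Matrix.mulVec, dotProduct]
  have h2 : (wMat : GL (Fin 2) A).1.mulVec ![1, (a : A)] = (a : A) • ![1, (b : A)] := by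
    funext j; fin_cases j <;> simp [wMat, Matrix.mulVec, dotProduct, mul_comm, ← h]
  ext i : 2
  fin_cases i
  exacts [map_line _ 1 h1, map_line _ (-1) h0, map_line _ a h2]

theorem XRep_wMat_symChainAt (a b : Aˣ) (h : (b : A) * a = -1) :
    XRep A 2 wMat (symChainAt a) = symChainAt b := by
  rw [symChainAt, map_add, XRep_single, XRep_single, wMat_smul a b h, wMat_smul_triZeroInf a b h,
    symChainAt, add_comm]

theorem cls_congr {x y : X A 2} (h : x = y) (hx : x ∈ Z₂ A) (hy : y ∈ Z₂ A) :
    cls ⟨x, hx⟩ = cls ⟨y, hy⟩ := by subst h; rfl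

theorem cls_sub_eq {x y z : X A 2} (h : x = y - z) (hx : x ∈ Z₂ A) (hy : y ∈ Z₂ A)
    (hz : z ∈ Z₂ A) : cls ⟨x, hx⟩ = cls ⟨y, hy⟩ - cls ⟨z, hz⟩ := by
  subst h
  exact map_sub cls ⟨y, hy⟩ ⟨z, hz⟩

/-- The matrix w takes (∞, 0, a) + (0, ∞, a) to the chain at -1/a; in particular it moves the base
chain from 1 to -1, which accounts for the correction ψ(-1). -/
theorem psi_wMat (a b : Aˣ) (h : (b : A) * a = -1) : psi a = psi b - psi (-1) := by
  rw [psi_eq_cls, ← cls_ZRep_of_det wMat det_wMat]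
  refine cls_sub_eq ?_ _ (psiChain_mem b) (psiChain_mem (-1))
  change XRep A 2 wMat (psiChain a) = _
  rw [psiChain_eq, map_sub, XRep_wMat_symChainAt a b h, XRep_wMat_symChainAt 1 (-1) (by simp),
    psiChain_eq, psiChain_eq, sub_sub_sub_cancel_right]

theorem of_smul_psi (a b : Aˣ) :
    MonoidAlgebra.of ℤ (SqClass A) (QuotientGroup.mk a) • psi b = psi (a * b) - psi a := by
  rw [psi_eq_cls, ← cls_diagUnit]
  refine cls_sub_eq ?_ _ (psiChain_mem _) (psiChain_mem _)
  change XRep A 2 (diagUnit A a) (psiChain b) = _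
  rw [psiChain_eq, map_sub, XRep_diag_symChainAt _ 1 a b (a * b) (by simp [diagUnit]) (by simp),
    XRep_diag_symChainAt _ 1 a 1 a (by simp [diagUnit]) (by simp), psiChain_eq, psiChain_eq,
    sub_sub_sub_cancel_right]

theorem psi_sq_mul (a b : Aˣ) : psi b = psi (a * a * b) - psi (a * a) := by
  have h : (QuotientGroup.mk (a * a) : SqClass A) = 1 :=
    (QuotientGroup.eq_one_iff (a * a)).2 (Subgroup.mem_square.2 ⟨a, rfl⟩)
  rw [← of_smul_psi, h, map_one, one_smul]

/-- The left side is ψ(-a) - ψ(a). Inversion by w writes ψ(a) as ψ(-a⁻¹) - ψ(-1), and triviality of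
⟨a⁻²⟩ writes ψ(-a) as ψ(-a⁻¹) - ψ(a⁻²). Hence each ψ(a⁻²) lies in the submodule generated by ψ(-1),
and that submodule is additively generated by such differences. -/
theorem of_smul_psi_neg_one (a : Aˣ) :
    MonoidAlgebra.of ℤ (SqClass A) (QuotientGroup.mk a) • psi (-1) =
      psi (-1) - psi (a⁻¹ * a⁻¹) := by
  have h1 := psi_wMat a (-a⁻¹) (by simp)
  have h2 := psi_sq_mul a⁻¹ (-a)
  rw [of_smul_psi, mul_neg_one, h1, h2, show a⁻¹ * a⁻¹ * -a = -a⁻¹ by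
    rw [mul_neg, mul_assoc, inv_mul_cancel, mul_one]]
  abel

theorem mk_wSL_eq : Matrix.SpecialLinearGroup.toGL (wSL : SL(2, A)) = wMat := Units.ext rfl

theorem act_symChain_of_mem_T {t : SL(2, A)} (ht : t ∈ T A) :
    ∃ a : Aˣ, act (QuotientGroup.mk t : PSL(2, A)) (symChainAt 1) = symChainAt (a⁻¹ * a⁻¹) := by
  -- For t = diag(a, a⁻¹), e₁ + e₂ goes to ae₁ + a⁻¹e₂, which spans the line of e₁ + a⁻²e₂.
  have hdet := t.det_coe
  rw [Matrix.det_fin_two, ht.1, zero_mul, sub_zero] at hdet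
  let a : Aˣ := ⟨t 0 0, t 1 1, hdet, by rw [mul_comm, hdet]⟩
  refine ⟨a, ?_⟩
  rw [act_mk]
  refine XRep_diag_symChainAt _ a a⁻¹ 1 _ ?_ (by simp)
  ext i j
  fin_cases i <;> fin_cases j <;> simp [ht.1, ht.2, a]

/-- Monomial matrices map `(∞, 0, 1) + (0, ∞, 1)` to `(∞, 0, b) + (0, ∞, b)`, where `ψ(b)` is a
multiple of `ψ(-1)`. -/
theorem exists_act_symChain {k : PSL(2, A)} (hk : k ∈ PSM A) :
    ∃ b : Aˣ, act k (symChainAt 1) = symChainAt b ∧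
      psi b ∈ Submodule.span (SqRing A) {psi (-1 : Aˣ)} := by
  have hmem := Submodule.mem_span_singleton_self (R := SqRing A) (psi (-1 : Aˣ))
  have key : ∀ a : Aˣ, psi (a⁻¹ * a⁻¹) ∈ Submodule.span (SqRing A) {psi (-1 : Aˣ)} := fun a => by
    rw [← sub_sub_cancel (psi (-1)) (psi (a⁻¹ * a⁻¹)), ← of_smul_psi_neg_one]
    exact sub_mem hmem (Submodule.smul_mem _ _ hmem)
  obtain ⟨k, rfl⟩ := QuotientGroup.mk_surjective k
  rw [mk_mem_proj center_le_SM] at hk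
  rcases SM_cases hk with h | h
  · obtain ⟨a, ha⟩ := act_symChain_of_mem_T h
    exact ⟨_, ha, key a⟩
  · obtain ⟨a, ha⟩ := act_symChain_of_mem_T h
    -- Here k = w t with t diagonal: t moves the parameter 1 to a⁻², and w sends it to -1/a⁻² = -a².
    refine ⟨-(a * a), ?_, ?_⟩
    · rw [← mul_inv_cancel_left wSL k, QuotientGroup.mk_mul, act_mul, ha, act_mk, mk_wSL_eq,
        XRep_wMat_symChainAt _ (-(a * a)) (by simp [mul_assoc])]
    · rw [← sub_add_cancel (psi (-(a * a))) (psi (-1)),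
        ← psi_wMat (a⁻¹ * a⁻¹) (-(a * a)) (by simp [mul_assoc])]
      exact add_mem (key a) hmem

theorem cls_act_symChain_sub_mem {k : PSL(2, A)} (hk : k ∈ PSM A)
    (h : act k (symChainAt 1) - symChainAt 1 ∈ Z₂ A) :
    cls ⟨act k (symChainAt 1) - symChainAt 1, h⟩ ∈
      Submodule.span (SqRing A) {psi (-1 : Aˣ)} := by
  obtain ⟨b, hb, hb'⟩ := exists_act_symChain hk
  rwa [cls_congr (by rw [hb, ← psiChain_eq]) _ (psiChain_mem _)]

end Classes

end RefinedScissors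

/-! ### Symmetric edge chains and their fillings -/

namespace RefinedScissors

section Transfer

variable {A : Type u} [CommRing A]

variable (A) in
/-- Chains on `PSL_2(A)/PSM_2(A)`. -/
abbrev EdgeClassChain : Type u := (PSL(2, A) ⧸ PSM A) →₀ ℤ

/-- The action of `PSL_2(A)` on chains on `PSL_2(A)/PSM_2(A)`. -/
def actClass (g : PSL(2, A)) : EdgeClassChain A →ₗ[ℤ] EdgeClassChain A :=
  Finsupp.lmapDomain ℤ ℤ (g • ·)

@[simp]
theorem actClass_single (g : PSL(2, A)) (w : PSL(2, A) ⧸ PSM A) (m : ℤ) :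
    actClass g (Finsupp.single w m) = Finsupp.single (g • w) m := Finsupp.mapDomain_single

variable (A) in
/-- The linear map which sends the class of `g` to `(∞, 0, 1) + (0, ∞, 1)`, translated by the
chosen representative of this class. -/
def fillEdges : EdgeClassChain A →ₗ[ℤ] X A 2 :=
  Finsupp.linearCombination ℤ fun w => act w.out (symChainAt 1)

variable (A) in
/-- The linear map which sends the class of an edge `e` to `e + swap e`. -/
def symEdges : EdgeClassChain A →ₗ[ℤ] X A 1 :=
  Finsupp.linearCombination ℤ fun w =>
    act w.out (Finsupp.single (edge A) 1 + Finsupp.single (swap (edge A)) 1)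

open Classical in
variable (A) in
/-- The linear map which keeps the coefficients at the chosen representatives of the edges up to
interchange. -/
def coeffEdges : X A 1 →ₗ[ℤ] EdgeClassChain A :=
  Finsupp.linearCombination ℤ fun p =>
    if p = (edgeClass p).out • edge A then Finsupp.single (edgeClass p) 1 else 0

theorem bdry_symChainAt_one :
    bdry A 1 (symChainAt 1) = Finsupp.single (edge A) 1 + Finsupp.single (swap (edge A)) 1 := by
  have h1 : face 0 (triInfZero (1 : Aˣ)) = face 1 (triZeroInf 1) := by
    ext i : 2; fin_cases i <;> rfl
  have h2 : face 1 (triInfZero (1 : Aˣ)) = face 0 (triZeroInf 1) := by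
    ext i : 2; fin_cases i <;> rfl
  have h3 : face 2 (triInfZero (1 : Aˣ)) = edge A := by
    ext i : 2; fin_cases i <;> rfl
  have h4 : face 2 (triZeroInf (1 : Aˣ)) = swap (edge A) := by
    ext i : 2; fin_cases i <;> rfl
  rw [bdry_one_apply]
  simp only [bdryTwo, symChainAt, Finsupp.mapDomain_add, Finsupp.mapDomain_single, h1, h2, h3, h4]
  abel

theorem bdry_fillEdges (c : EdgeClassChain A) : bdry A 1 (fillEdges A c) = symEdges A c := by
  suffices h : bdry A 1 ∘ₗ fillEdges A = symEdges A from LinearMap.congr_fun h c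
  refine Finsupp.lhom_ext fun w m => ?_
  rw [LinearMap.comp_apply, fillEdges, symEdges, Finsupp.linearCombination_single,
    Finsupp.linearCombination_single, map_smul, bdry_act, bdry_symChainAt_one]

theorem exists_out_smul (g : PSL(2, A)) (w : PSL(2, A) ⧸ PSM A) :
    ∃ k ∈ PSM A, g * w.out = (g • w).out * k := by
  refine ⟨(g • w).out⁻¹ * (g * w.out), QuotientGroup.eq.1 ?_, by rw [mul_inv_cancel_left]⟩
  rw [QuotientGroup.out_eq']
  conv_lhs => rw [← QuotientGroup.out_eq' w]
  rfl

theorem act_symEdge {k : PSL(2, A)} (hk : k ∈ PSM A) :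
    act k (Finsupp.single (edge A) (1 : ℤ) + Finsupp.single (swap (edge A)) 1) =
      Finsupp.single (edge A) 1 + Finsupp.single (swap (edge A)) 1 := by
  rw [map_add, act_single, act_single, ← swap_smul]
  rcases smul_edge_of_mem_PSM hk with h | h
  · rw [h]
  · rw [h, swap_swap, add_comm]

/-- PSM fixes e + swap e for the base edge e, so the chosen coset representatives do not matter. For
`fillEdges` they do matter, and this is where ψ(-1) enters. -/
theorem symEdges_actClass (g : PSL(2, A)) (c : EdgeClassChain A) :
    symEdges A (actClass g c) = act g (symEdges A c) := by
  suffices h : symEdges A ∘ₗ actClass g = act g ∘ₗ symEdges A from LinearMap.congr_fun h c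
  refine Finsupp.lhom_ext fun w m => ?_
  obtain ⟨k, hk, e⟩ := exists_out_smul g w
  rw [LinearMap.comp_apply, LinearMap.comp_apply, actClass_single, symEdges,
    Finsupp.linearCombination_single, Finsupp.linearCombination_single, map_smul, ← act_mul, e,
    act_mul, act_symEdge hk]

theorem edgeClass_out_smul (w : PSL(2, A) ⧸ PSM A) : edgeClass (w.out • edge A) = w := by
  rw [edgeClass_smul_edge, QuotientGroup.out_eq']

theorem symEdges_single (w : PSL(2, A) ⧸ PSM A) :
    symEdges A (Finsupp.single w 1) = Finsupp.single (w.out • edge A) 1 +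
      Finsupp.single (swap (w.out • edge A)) 1 := by
  rw [symEdges, Finsupp.linearCombination_single, one_smul, map_add, act_single, act_single,
    swap_smul]

theorem coeffEdges_out (w : PSL(2, A) ⧸ PSM A) :
    coeffEdges A (Finsupp.single (w.out • edge A) 1) = Finsupp.single w 1 := by
  rw [coeffEdges, Finsupp.linearCombination_single, one_smul, edgeClass_out_smul, if_pos rfl]

/-- By transitivity it suffices to see that ∞ and 0 are different lines, which fails exactly over
the zero ring. -/
theorem swap_ne [Nontrivial A] (p : Simplex A 1) : swap p ≠ p := by
  intro h
  obtain ⟨g, rfl⟩ := exists_psl_smul_edge p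
  rw [swap_smul] at h
  have h' : (![1, 0] : Fin 2 → A) ∈ Submodule.span A {(![0, 1] : Fin 2 → A)} := by
    have := congrFun (congrArg Simplex.line (MulAction.injective g h)) 0
    change Submodule.span A {(![0, 1] : Fin 2 → A)} = Submodule.span A {![1, 0]} at this
    rw [this]
    exact Submodule.mem_span_singleton_self _
  obtain ⟨c, hc⟩ := Submodule.mem_span_singleton.1 h'
  simpa using congrFun hc 0

variable [Nontrivial A]

theorem coeffEdges_swap_out (w : PSL(2, A) ⧸ PSM A) :
    coeffEdges A (Finsupp.single (swap (w.out • edge A)) 1) = 0 := by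
  rw [coeffEdges, Finsupp.linearCombination_single, one_smul, edgeClass_swap, edgeClass_out_smul,
    if_neg (swap_ne _)]

theorem coeffEdges_symEdges (c : EdgeClassChain A) : coeffEdges A (symEdges A c) = c := by
  suffices h : coeffEdges A ∘ₗ symEdges A = LinearMap.id from LinearMap.congr_fun h c
  refine Finsupp.lhom_ext' fun w => LinearMap.ext_ring ?_
  change coeffEdges A (symEdges A (Finsupp.single w 1)) = Finsupp.single w 1
  rw [symEdges_single, map_add, coeffEdges_out, coeffEdges_swap_out, add_zero]

/-- A chain of edges which is invariant under the interchange of lines is a sum of chains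
`e + swap e`. -/
theorem symEdges_coeffEdges {y : X A 1} (hy : swapChain A y = y) :
    symEdges A (coeffEdges A y) = y := by
  -- The identity is first proved on symmetrizations y + swap y, where it can be checked on basis
  -- elements. For invariant y this is the identity for 2y, and chains are torsion-free.
  have h : symEdges A ∘ₗ coeffEdges A ∘ₗ (LinearMap.id + swapChain A) =
      LinearMap.id + swapChain A := by
    refine Finsupp.lhom_ext' fun p => LinearMap.ext_ring ?_
    rw [LinearMap.comp_apply, LinearMap.comp_apply, LinearMap.comp_apply, LinearMap.comp_apply,
      LinearMap.add_apply, LinearMap.id_apply, Finsupp.lsingle_apply, swapChain_single, map_add]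
    obtain ⟨w, e⟩ : ∃ w : PSL(2, A) ⧸ PSM A, p = w.out • edge A ∨ p = swap (w.out • edge A) :=
      ⟨edgeClass p, eq_or_eq_swap (edgeClass_out_smul (edgeClass p))⟩
    rcases e with rfl | rfl
    · rw [coeffEdges_out, coeffEdges_swap_out, add_zero, symEdges_single]
    · rw [swap_swap, coeffEdges_out, coeffEdges_swap_out, zero_add, symEdges_single, add_comm]
  have h' : symEdges A (coeffEdges A (y + swapChain A y)) = y + swapChain A y := by
    have := LinearMap.congr_fun h y
    rwa [LinearMap.comp_apply, LinearMap.comp_apply, LinearMap.add_apply,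
      LinearMap.id_apply] at this
  rw [hy, ← two_smul ℤ y, map_smul, map_smul] at h'
  exact smul_right_injective (X A 1) (two_ne_zero (α := ℤ)) h'

theorem coeffEdges_act (g : PSL(2, A)) {y : X A 1} (hy : swapChain A y = y) :
    coeffEdges A (act g y) = actClass g (coeffEdges A y) := by
  conv_lhs => rw [← symEdges_coeffEdges hy, ← symEdges_actClass, coeffEdges_symEdges]

end Transfer

/-! ### The retraction onto cycles, equivariant modulo ψ(-1) -/

section Retraction

variable {A : Type u} [CommRing A]

variable (A) in
/-- The multiples of `ψ(-1)` in `ℛ𝒫(A)`. -/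
abbrev psiSpan : Submodule (SqRing A) (RP A) := Submodule.span (SqRing A) {psi (-1 : Aˣ)}

variable (A) in
/-- The class of a cycle modulo the multiples of `ψ(-1)`. -/
def clsMod : Z₂ A →+ RP A ⧸ psiSpan A := (psiSpan A).mkQ.toAddMonoidHom.comp cls

theorem clsMod_eq_zero_iff (z : Z₂ A) : clsMod A z = 0 ↔ cls z ∈ psiSpan A :=
  Submodule.Quotient.mk_eq_zero _

variable (A) in
/-- The chains whose boundary is invariant under the interchange of lines. -/
def symChains : Submodule ℤ (X A 2) := LinearMap.ker (swapChain A ∘ₗ bdry A 1 - bdry A 1)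

theorem mem_symChains {x : X A 2} : x ∈ symChains A ↔ swapChain A (bdry A 1 x) = bdry A 1 x := by
  rw [symChains, LinearMap.mem_ker, LinearMap.sub_apply, sub_eq_zero, LinearMap.comp_apply]

theorem act_mem_symChains (g : PSL(2, A)) {x : X A 2} (hx : x ∈ symChains A) :
    act g x ∈ symChains A := by
  rw [mem_symChains] at hx ⊢
  rw [bdry_act, swapChain_act, hx]

theorem Z₂_le_symChains : Z₂ A ≤ symChains A := fun z hz => by
  rw [mem_symChains, show bdry A 1 z = 0 from hz, map_zero]

theorem act_fillEdges_sub_mem (g : PSL(2, A)) (c : EdgeClassChain A) :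
    act g (fillEdges A c) - fillEdges A (actClass g c) ∈ Z₂ A := by
  change bdry A 1 _ = 0
  rw [map_sub, bdry_act, bdry_fillEdges, bdry_fillEdges, symEdges_actClass, sub_self]

/-- On a coset w, the representative of g • w differs from g • w.out by some k in PSM. The defect is
therefore a translate of k(s) - s with s = (∞, 0, 1) + (0, ∞, 1), whose class is a ψ(b) in the
submodule generated by ψ(-1). -/
theorem clsMod_act_fillEdges (g : PSL(2, A)) (c : EdgeClassChain A) :
    clsMod A ⟨_, act_fillEdges_sub_mem g c⟩ = 0 := by
  let f : EdgeClassChain A →+ RP A ⧸ psiSpan A := (clsMod A).comp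
    ((act g ∘ₗ fillEdges A - fillEdges A ∘ₗ actClass g).codRestrict (Z₂ A)
      (act_fillEdges_sub_mem g)).toAddMonoidHom
  suffices h : f = 0 from DFunLike.congr_fun h c
  refine Finsupp.addHom_ext' fun w => AddMonoidHom.ext_int ?_
  refine (clsMod_eq_zero_iff _).2 ?_
  obtain ⟨k, hk, e⟩ := exists_out_smul g w
  have h : act g (fillEdges A (Finsupp.single w 1)) -
      fillEdges A (actClass g (Finsupp.single w 1)) =
      act (g • w).out (act k (symChainAt 1) - symChainAt 1) := by
    rw [actClass_single, fillEdges, Finsupp.linearCombination_single,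
      Finsupp.linearCombination_single, one_smul, one_smul, ← act_mul, e, act_mul, map_sub]
  have hk' : act k (symChainAt 1) - symChainAt 1 ∈ Z₂ A := by
    obtain ⟨b, hb, -⟩ := exists_act_symChain hk
    rw [hb, ← psiChain_eq]
    exact psiChain_mem b
  have h' := cls_act_symChain_sub_mem hk hk'
  rw [← cls_act (g • w).out hk', ← cls_congr h (act_fillEdges_sub_mem g _)] at h'
  exact h'

variable [Nontrivial A]

variable (A) in
/-- The retraction of the chains with symmetric boundary to the cycles. -/
def toCycle : symChains A →+ Z₂ A :=
  (((LinearMap.id - fillEdges A ∘ₗ coeffEdges A ∘ₗ bdry A 1) ∘ₗ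
    (symChains A).subtype).codRestrict (Z₂ A) fun x => by
      change bdry A 1 (x.1 - fillEdges A (coeffEdges A (bdry A 1 x.1))) = 0
      rw [map_sub, bdry_fillEdges, symEdges_coeffEdges (mem_symChains.1 x.2),
        sub_self]).toAddMonoidHom

theorem toCycle_apply (x : symChains A) :
    (toCycle A x).1 = x.1 - fillEdges A (coeffEdges A (bdry A 1 x.1)) := rfl

theorem toCycle_of_mem (z : Z₂ A) : toCycle A ⟨z.1, Z₂_le_symChains z.2⟩ = z := by
  refine Subtype.ext ?_
  rw [toCycle_apply]
  change z.1 - fillEdges A (coeffEdges A (bdry A 1 z.1)) = z.1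
  rw [show bdry A 1 z.1 = 0 from z.2, map_zero, map_zero, sub_zero]

/-- The failure of `toCycle` to commute with g is the defect of `fillEdges` on the edge coefficients
of ∂x, which vanishes modulo ψ(-1). -/
theorem clsMod_toCycle_act (g : PSL(2, A)) (x : symChains A) :
    clsMod A (toCycle A ⟨act g x.1, act_mem_symChains g x.2⟩) = clsMod A (toCycle A x) := by
  have h1 : clsMod A ⟨act g (toCycle A x).1, act_mem g (toCycle A x).2⟩ =
      clsMod A (toCycle A x) := congrArg (psiSpan A).mkQ (cls_act g (toCycle A x).2)
  rw [← h1, ← sub_eq_zero, ← map_sub,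
    ← clsMod_act_fillEdges g (coeffEdges A (bdry A 1 x.1))]
  refine congrArg _ (Subtype.ext ?_)
  change act g x.1 - fillEdges A (coeffEdges A (bdry A 1 (act g x.1))) - act g (toCycle A x).1 = _
  rw [toCycle_apply, bdry_act, coeffEdges_act g (mem_symChains.1 x.2), map_sub]
  exact sub_sub_sub_cancel_left _ _ _

end Retraction

end RefinedScissors

/-! ### Comparison of RP with the coinvariants of chains with symmetric boundary -/

namespace RefinedScissors

open PermRep

section Comparison

variable {A : Type u} [CommRing A]

theorem rho_chainEquiv (n : ℕ) (g : PSL(2, A)) (x : X A n) :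
    (perm (Simplex A n) (trivZ PSL(2, A))).ρ g (chainEquiv A n x) = chainEquiv A n (act g x) :=
  Finsupp.ext fun p => (DFunLike.congr_fun (chainEquiv_mapDomain (g • ·) x) p).symm

theorem chainEquiv_mem_iff (x : X A 2) :
    (altBdry A).hom (chainEquiv A 2 x) = 0 ↔ x ∈ symChains A := by
  rw [mem_ker_altBdry_iff, mem_symChains, bdryTwo_chainEquiv, ← chainEquiv_mapDomain,
    (chainEquiv A 1).injective.eq_iff, bdry_one_apply]
  rfl

variable (A) in
/-- Integral chains with symmetric boundary are the elements of the kernel of `altBdry`. -/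
def toKer : symChains A →+ ker (altBdry A) where
  toFun x := ⟨chainEquiv A 2 x.1, (chainEquiv_mem_iff x.1).2 x.2⟩
  map_zero' := Subtype.ext (map_zero (chainEquiv A 2))
  map_add' x y := Subtype.ext (map_add (chainEquiv A 2) x.1 y.1)

variable (A) in
/-- The inverse of `toKer`. -/
def ofKer : ker (altBdry A) →+ symChains A where
  toFun x := ⟨(chainEquiv A 2).symm x.1, (chainEquiv_mem_iff _).1 (by
    rw [AddEquiv.apply_symm_apply]; exact x.2)⟩
  map_zero' := Subtype.ext (map_zero (chainEquiv A 2).symm)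
  map_add' x y := Subtype.ext (map_add (chainEquiv A 2).symm x.1 y.1)

theorem ofKer_toKer (x : symChains A) : ofKer A (toKer A x) = x :=
  Subtype.ext ((chainEquiv A 2).symm_apply_apply x.1)

theorem toKer_ofKer (x : ker (altBdry A)) : toKer A (ofKer A x) = x :=
  Subtype.ext ((chainEquiv A 2).apply_symm_apply x.1)

theorem rho_toKer (g : PSL(2, A)) (x : symChains A) :
    (ker (altBdry A)).ρ g (toKer A x) = toKer A ⟨act g x.1, act_mem_symChains g x.2⟩ :=
  Subtype.ext (rho_chainEquiv 2 g x.1)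

variable (A) in
/-- The class of a chain with symmetric boundary in the coinvariants. -/
def symClass : symChains A →+ coinv (ker (altBdry A)) := (coinvMk _).comp (toKer A)

theorem symClass_act (g : PSL(2, A)) (x : symChains A) :
    symClass A ⟨act g x.1, act_mem_symChains g x.2⟩ = symClass A x := by
  refine Eq.trans ?_ (coinvMk_rho (ker (altBdry A)) g (toKer A x))
  rw [rho_toKer]
  rfl

theorem mk_toGL_surjective {g : GL (Fin 2) A} (hg : Matrix.GeneralLinearGroup.det g = 1) :
    ∃ h : SL(2, A), Matrix.SpecialLinearGroup.toGL h = g :=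
  ⟨⟨g.1, congrArg Units.val hg⟩, Units.ext rfl⟩

variable (A) in
/-- The map from `ℛ𝒫(A)` to the coinvariants of the chains with symmetric boundary. -/
def fromRP : RP A →+ coinv (ker (altBdry A)) :=
  (Representation.Coinvariants.lift (MonoidHom.comp (ZRep A) (SLsub A).subtype)
    ((symClass A).comp (Submodule.inclusion Z₂_le_symChains).toAddMonoidHom).toIntLinearMap
    fun g => LinearMap.ext fun z => by
      obtain ⟨h, hh⟩ := mk_toGL_surjective g.2
      refine Eq.trans ?_ (symClass_act (QuotientGroup.mk h) ⟨z.1, Z₂_le_symChains z.2⟩)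
      refine congrArg (symClass A) (Subtype.ext ?_)
      change XRep A 2 g.1 z.1 = act (QuotientGroup.mk h) z.1
      rw [act_mk, hh]).toAddMonoidHom.comp (RPRep A).asModuleEquiv.toAddMonoidHom

theorem fromRP_cls (z : Z₂ A) : fromRP A (cls z) = symClass A ⟨z.1, Z₂_le_symChains z.2⟩ := rfl

theorem symChainAt_one_mem : symChainAt 1 ∈ symChains A := by
  rw [mem_symChains, bdry_symChainAt_one, map_add, swapChain_single, swapChain_single, swap_swap,
    add_comm]

/-- ψ(b) is then a difference of two translates of one chain. That chain is not a cycle, but its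
boundary is symmetric, so the two classes cancel in the larger module of chains. -/
theorem fromRP_psi_of_act {k : PSL(2, A)} {b : Aˣ} (h : act k (symChainAt 1) = symChainAt b) :
    fromRP A (psi b) = 0 := by
  rw [psi_eq_cls, fromRP_cls]
  have e : (⟨psiChain b, Z₂_le_symChains (psiChain_mem b)⟩ : symChains A) =
      ⟨act k (symChainAt 1), act_mem_symChains k symChainAt_one_mem⟩ -
        ⟨symChainAt 1, symChainAt_one_mem⟩ :=
    Subtype.ext ((psiChain_eq b).trans (congrArg (· - symChainAt 1) h.symm))
  rw [e, map_sub, sub_eq_zero]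
  exact symClass_act k ⟨symChainAt 1, symChainAt_one_mem⟩

theorem fromRP_psi_neg_one : fromRP A (psi (-1)) = 0 :=
  fromRP_psi_of_act (k := QuotientGroup.mk wSL) (by
    rw [act_mk, mk_wSL_eq, XRep_wMat_symChainAt 1 (-1) (by simp)])

theorem fromRP_psi_sq (a : Aˣ) : fromRP A (psi (a * a)) = 0 := by
  let m : SL(2, A) := ⟨!![((a⁻¹ : Aˣ) : A), 0; 0, (a : A)], by simp [Matrix.det_fin_two]⟩
  exact fromRP_psi_of_act (k := QuotientGroup.mk m) (by
    rw [act_mk, XRep_diag_symChainAt _ a⁻¹ a 1 (a * a) rfl (by simp)])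

theorem fromRP_eq_zero_of_mem {r : RP A} (hr : r ∈ psiSpan A) : fromRP A r = 0 := by
  obtain ⟨s, rfl⟩ := Submodule.mem_span_singleton.1 hr
  -- `fromRP` is only additive, so group ring multiples of ψ(-1) are treated on group elements,
  -- where they become ψ(-1) - ψ(a⁻²).
  induction s using MonoidAlgebra.induction_on with
  | of a =>
    obtain ⟨a, rfl⟩ := QuotientGroup.mk_surjective a
    rw [of_smul_psi_neg_one, map_sub, fromRP_psi_neg_one, fromRP_psi_sq, sub_zero]
  | add x y hx hy =>
    rw [add_smul, map_add, hx (Submodule.smul_mem _ _ (Submodule.mem_span_singleton_self _)),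
      hy (Submodule.smul_mem _ _ (Submodule.mem_span_singleton_self _)), add_zero]
  | smul n x hx =>
    rw [smul_assoc, map_zsmul, hx (Submodule.smul_mem _ _ (Submodule.mem_span_singleton_self _)),
      smul_zero]

theorem fromRP_eq_zero_iff [Nontrivial A] (r : RP A) : fromRP A r = 0 ↔ r ∈ psiSpan A := by
  refine ⟨fun h => ?_, fromRP_eq_zero_of_mem⟩
  obtain ⟨z, rfl⟩ := cls_surjective r
  rw [fromRP_cls] at h
  rw [← clsMod_eq_zero_iff]
  -- The retraction to cycles modulo ψ(-1) is invariant, so it factors through the coinvariants; on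
  -- cycles it is the identity followed by `clsMod`.
  have h' := eq_zero_of_coinvMk_eq_zero ((clsMod A).comp ((toCycle A).comp (ofKer A)))
    (fun g x => by
      obtain ⟨x, rfl⟩ : ∃ y, toKer A y = x := ⟨_, toKer_ofKer x⟩
      rw [rho_toKer]
      change clsMod A (toCycle A (ofKer A _)) = clsMod A (toCycle A (ofKer A _))
      rw [ofKer_toKer, ofKer_toKer, clsMod_toCycle_act]) h
  change clsMod A (toCycle A (ofKer A (toKer A _))) = 0 at h'
  rwa [ofKer_toKer, toCycle_of_mem] at h'

/-- The two coinvariants agree: SL_2(A) acts on chains through PSL_2(A), and the coefficients differ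
only by a universe lift. The map to them is thus the same as the one defining RP_1. -/
theorem coinvMk_chainEquiv_eq_zero_iff (x : X A 2) :
    coinvMk (perm (Simplex A 2) (trivZ PSL(2, A))) (chainEquiv A 2 x) = 0 ↔
      Representation.Coinvariants.mk (MonoidHom.comp (XRep A 2) (SLsub A).subtype) x = 0 := by
  constructor
  · intro h
    have := eq_zero_of_coinvMk_eq_zero (M := perm (Simplex A 2) (trivZ PSL(2, A)))
      ((Representation.Coinvariants.mk
        (MonoidHom.comp (XRep A 2) (SLsub A).subtype)).toAddMonoidHom.comp
        (chainEquiv A 2).symm.toAddMonoidHom) (fun g y => by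
          obtain ⟨y, rfl⟩ := (chainEquiv A 2).surjective y
          obtain ⟨g, rfl⟩ := QuotientGroup.mk_surjective g
          rw [rho_chainEquiv]
          change Representation.Coinvariants.mk _ ((chainEquiv A 2).symm _) =
            Representation.Coinvariants.mk _ ((chainEquiv A 2).symm _)
          rw [AddEquiv.symm_apply_apply, AddEquiv.symm_apply_apply]
          exact Representation.Coinvariants.mk_self_apply
            (MonoidHom.comp (XRep A 2) (SLsub A).subtype)
            ⟨Matrix.SpecialLinearGroup.toGL g, Units.ext (by simp)⟩ y) h
    change Representation.Coinvariants.mk _ ((chainEquiv A 2).symm _) = 0 at this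
    rwa [AddEquiv.symm_apply_apply] at this
  · intro h
    let f := Representation.Coinvariants.lift (MonoidHom.comp (XRep A 2) (SLsub A).subtype)
      ((coinvMk (perm (Simplex A 2) (trivZ PSL(2, A)))).comp
        (chainEquiv A 2).toAddMonoidHom).toIntLinearMap fun g => LinearMap.ext fun x => by
          obtain ⟨h, hh⟩ := mk_toGL_surjective g.2
          refine Eq.trans ?_ (coinvMk_rho (perm (Simplex A 2) (trivZ PSL(2, A)))
            (QuotientGroup.mk h) (chainEquiv A 2 x))
          rw [rho_chainEquiv, act_mk, hh]
          rfl
    exact (congrArg f h).trans (map_zero f)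

/-- `fromRP` is compatible with the maps to the coinvariants of the `2`-chains. -/
theorem coinvMap_fromRP_eq_zero_iff (r : RP A) :
    coinvMap (kerι (altBdry A)) (fromRP A r) = 0 ↔ r ∈ RP₁ A := by
  obtain ⟨z, rfl⟩ := cls_surjective r
  exact coinvMk_chainEquiv_eq_zero_iff z.1

/-- The sum of the coefficients. -/
def total {α : Type*} : (α →₀ ℤ) →ₗ[ℤ] ℤ := Finsupp.linearCombination ℤ fun _ => 1

@[simp]
theorem total_single {α : Type*} (a : α) (m : ℤ) : total (Finsupp.single a m) = m := by
  simp [total]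

theorem total_mapDomain {α β : Type*} (f : α → β) (x : α →₀ ℤ) :
    total (Finsupp.mapDomain f x) = total x := by
  simp [total, Finsupp.linearCombination_mapDomain, Function.comp_def]

/-- Each triple contributes 1 - 1 + 1 = 1. -/
theorem total_bdry (x : X A 2) : total (bdry A 1 x) = total x := by
  rw [bdry_one_apply, bdryTwo, map_add, map_sub, total_mapDomain, total_mapDomain, total_mapDomain,
    sub_self, zero_add]

theorem total_symEdges (c : EdgeClassChain A) : total (symEdges A c) = 2 * total c := by
  suffices h : total ∘ₗ symEdges A = (2 : ℤ) • total from LinearMap.congr_fun h c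
  refine Finsupp.lhom_ext' fun w => LinearMap.ext_ring ?_
  rw [LinearMap.comp_apply, LinearMap.comp_apply, Finsupp.lsingle_apply, symEdges_single, map_add,
    total_single, total_single, LinearMap.comp_apply, Finsupp.lsingle_apply, LinearMap.smul_apply,
    total_single]
  rfl

theorem fillEdges_mem (c : EdgeClassChain A) : fillEdges A c ∈ symChains A := by
  induction c using Finsupp.induction_linear with
  | zero => rw [map_zero]; exact zero_mem _
  | add c c' hc hc' => rw [map_add]; exact add_mem hc hc'
  | single w m =>
    rw [fillEdges, Finsupp.linearCombination_single]
    exact Submodule.smul_mem _ _ (act_mem_symChains _ symChainAt_one_mem)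

theorem symClass_fillEdges (c : EdgeClassChain A) :
    symClass A ⟨fillEdges A c, fillEdges_mem c⟩ =
      total c • symClass A ⟨symChainAt 1, symChainAt_one_mem⟩ := by
  suffices h : (symClass A).comp ((fillEdges A).codRestrict (symChains A)
      fillEdges_mem).toAddMonoidHom = ((total (α := PSL(2, A) ⧸ PSM A)).smulRight
        (symClass A ⟨symChainAt 1, symChainAt_one_mem⟩)).toAddMonoidHom from DFunLike.congr_fun h c
  refine Finsupp.addHom_ext' fun w => AddMonoidHom.ext_int ?_
  change symClass A ⟨fillEdges A (Finsupp.single w 1), fillEdges_mem _⟩ =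
    total (Finsupp.single w 1) • symClass A _
  rw [total_single, one_smul, ← symClass_act w.out ⟨symChainAt 1, symChainAt_one_mem⟩]
  refine congrArg _ (Subtype.ext ?_)
  change fillEdges A (Finsupp.single w 1) = _
  rw [fillEdges, Finsupp.linearCombination_single, one_smul]

theorem total_eq_zero_of_coinvMk_eq_zero {x : X A 2}
    (h : coinvMk (perm (Simplex A 2) (trivZ PSL(2, A))) (chainEquiv A 2 x) = 0) :
    total x = 0 := by
  have := eq_zero_of_coinvMk_eq_zero (M := perm (Simplex A 2) (trivZ PSL(2, A)))
    (total.toAddMonoidHom.comp (chainEquiv A 2).symm.toAddMonoidHom) (fun g y => by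
      obtain ⟨y, rfl⟩ := (chainEquiv A 2).surjective y
      rw [rho_chainEquiv]
      change total ((chainEquiv A 2).symm _) = total ((chainEquiv A 2).symm _)
      rw [AddEquiv.symm_apply_apply, AddEquiv.symm_apply_apply]
      exact total_mapDomain _ _) h
  change total ((chainEquiv A 2).symm _) = 0 at this
  rwa [AddEquiv.symm_apply_apply] at this

/-- The chain x is its cycle part plus the filling of its edge coefficients c, and the class of that
filling is total(c) times the class of (∞, 0, 1) + (0, ∞, 1). Vanishing in (X_2)_G gives total x =
0; since total x = total ∂x = 2 total(c), the filling contributes nothing. -/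
theorem exists_fromRP [Nontrivial A] {y : coinv (ker (altBdry A))}
    (hy : coinvMap (kerι (altBdry A)) y = 0) : ∃ r, fromRP A r = y := by
  obtain ⟨p, rfl⟩ := coinvMk_surjective _ y
  obtain ⟨x, rfl⟩ : ∃ x, toKer A x = p := ⟨_, toKer_ofKer p⟩
  have h0 : total x.1 = 0 := total_eq_zero_of_coinvMk_eq_zero hy
  have h1 : total (coeffEdges A (bdry A 1 x.1)) = 0 := by
    have := total_symEdges (coeffEdges A (bdry A 1 x.1))
    rw [symEdges_coeffEdges (mem_symChains.1 x.2), total_bdry, h0] at this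
    omega
  refine ⟨cls (toCycle A x), ?_⟩
  have h2 := symClass_fillEdges (coeffEdges A (bdry A 1 x.1))
  rw [h1, zero_smul] at h2
  rw [fromRP_cls]
  have e : (⟨(toCycle A x).1, Z₂_le_symChains (toCycle A x).2⟩ : symChains A) =
      x - ⟨fillEdges A (coeffEdges A (bdry A 1 x.1)), fillEdges_mem _⟩ := Subtype.ext rfl
  rw [e, map_sub, h2, sub_zero]
  rfl

end Comparison

/-! ### Assembly of the isomorphism and the zero ring -/

section Conclusion

variable (A : Type u) [CommRing A]

theorem mem_span_psiNegOne_iff (r : RP₁ A) :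
    r ∈ Submodule.span (SqRing A) {psiNegOne A} ↔ r.1 ∈ psiSpan A := by
  rw [Submodule.mem_span_singleton, Submodule.mem_span_singleton]
  exact exists_congr fun s => Subtype.ext_iff

theorem coinvMap_ker_equiv [Nontrivial A] :
    Nonempty ((coinvMap (kerι (altBdry A))).ker ≃+
      (RP₁ A ⧸ Submodule.span (SqRing A) {psiNegOne A})) := by
  let f : RP₁ A →+ (coinvMap (kerι (altBdry A))).ker :=
    ((fromRP A).comp (RP₁ A).subtype.toAddMonoidHom).codRestrict _ fun r =>
      (coinvMap_fromRP_eq_zero_iff r.1).2 r.2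
  have hf : Function.Surjective f := fun y => by
    obtain ⟨r, hr⟩ := exists_fromRP y.2
    exact ⟨⟨r, (coinvMap_fromRP_eq_zero_iff r).1 (by rw [hr]; exact y.2)⟩, Subtype.ext hr⟩
  have hk : (Submodule.span (SqRing A) {psiNegOne A}).toAddSubgroup = f.ker := by
    ext r
    refine (mem_span_psiNegOne_iff A r).trans ((fromRP_eq_zero_iff r.1).symm.trans ?_)
    exact ⟨fun h => Subtype.ext h, fun h => congrArg Subtype.val h⟩
  exact ⟨((QuotientAddGroup.quotientAddEquivOfEq hk).trans
    (QuotientAddGroup.quotientKerEquivOfSurjective f hf)).symm⟩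

theorem coinvMap_ker_equiv_of_subsingleton [Subsingleton A] :
    Nonempty ((coinvMap (kerι (altBdry A))).ker ≃+
      (RP₁ A ⧸ Submodule.span (SqRing A) {psiNegOne A})) := by
  -- Over the zero ring an edge equals its reversal, so the argument through fillings is
  -- unavailable. There is at most one simplex in each dimension and the action is trivial; both
  -- sides vanish, since ∂₂ is injective and passing to coinvariants changes nothing.
  have hS : ∀ n, Subsingleton (Simplex A n) := fun n =>
    ⟨fun p p' => Simplex.ext (funext fun i => Subsingleton.elim _ _)⟩
  have hact : ∀ (g : PSL(2, A)) (x : X A 2), act g x = x := fun g x => by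
    have h : (g • · : Simplex A 2 → Simplex A 2) = id := funext fun p => (hS 2).elim _ _
    change Finsupp.mapDomain (g • ·) x = x
    rw [h, Finsupp.mapDomain_id]
  have h1 : Subsingleton (coinvMap (kerι (altBdry A))).ker := by
    refine subsingleton_of_forall_eq 0 fun y => Subtype.ext ?_
    obtain ⟨p, hp⟩ := coinvMk_surjective _ y.1
    have hy : coinvMap (kerι (altBdry A)) y.1 = 0 := y.2
    rw [← hp] at hy
    have : p.1 = 0 := eq_zero_of_coinvMk_eq_zero
      (M := perm (Simplex A 2) (trivZ PSL(2, A))) (AddMonoidHom.id _) (fun g x => by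
        obtain ⟨x, rfl⟩ := (chainEquiv A 2).surjective x
        rw [rho_chainEquiv, hact]) hy
    rw [← hp, show p = 0 from Subtype.ext this, map_zero]
    rfl
  have h2 : Subsingleton (RP₁ A) := by
    refine subsingleton_of_forall_eq 0 fun r => Subtype.ext ?_
    obtain ⟨z, hz⟩ := cls_surjective r.1
    have h0 : bdryTwo z.1 = 0 := by rw [← bdry_one_apply]; exact z.2
    have h01 : (face 0 : Simplex A 2 → Simplex A 1) = face 1 := funext fun p => (hS 1).elim _ _
    have h2 : Function.Injective (face 2 : Simplex A 2 → Simplex A 1) := fun p p' _ =>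
      (hS 2).elim _ _
    rw [bdryTwo, h01, sub_self, zero_add] at h0
    have : z = 0 := Subtype.ext (Finsupp.mapDomain_injective h2
      (h0.trans Finsupp.mapDomain_zero.symm))
    rw [← hz, this, map_zero]
    rfl
  have h3 : Subsingleton (RP₁ A ⧸ Submodule.span (SqRing A) {psiNegOne A}) :=
    (Submodule.mkQ_surjective _).subsingleton
  exact ⟨⟨⟨fun _ => 0, fun _ => 0, fun _ => Subsingleton.elim _ _, fun _ => Subsingleton.elim _ _⟩,
    fun _ _ => Subsingleton.elim _ _⟩⟩

end Conclusion

end RefinedScissors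

end

theorem theorem4p2 (A : Type u) [CommRing A]
    (hX : RefinedScissors.ExactBelowTwo A)
    (hμ : ∀ a : A, a ^ 2 = 1 → a = 1 ∨ a = -1)
    (hPB : ∀ i : ℕ, i = 2 ∨ i = 3 → Function.Bijective
      (RefinedScissors.homologyMapZ (Subgroup.inclusion (RefinedScissors.PT_le_PB A)) i)) :
    Nonempty (RefinedScissors.relHomology (RefinedScissors.PSM A) 3 ≃+
      (RefinedScissors.RP₁ A ⧸
        Submodule.span (RefinedScissors.SqRing A) {RefinedScissors.psiNegOne A})) := by
  obtain ⟨e⟩ := RefinedScissors.relHomology_PSM_equiv hX hPB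
  rcases subsingleton_or_nontrivial A with h | h
  · obtain ⟨e'⟩ := RefinedScissors.coinvMap_ker_equiv_of_subsingleton A
    exact ⟨e.trans e'⟩
  · obtain ⟨e'⟩ := RefinedScissors.coinvMap_ker_equiv A
    exact ⟨e.trans e'⟩
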